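/- **Proposition (the geometric Kannan–Lovász–Simonovits lemma).** Let $n \ge 0$ be an integer, let $F \subset \mathbb{R}^n$ be a compact convex set with non-empty interior, let $E \subset F$ be a closed set, and let $\lambda > 1$ be a real number. Define the core of $E$ by $$E_{\lambda,F} := \Bigl\{ x \in E : \ \text{for every non-degenerate line segment } J \text{ with } x \in J \subset F,\quad \frac{|E \cap J|}{|J|} \ge \frac{\lambda-1}{\lambda} \Bigr\},$$ where $|\cdot|$ denotes one-dimensional length. Then $$\frac{\operatorname{Vol}(E_{\lambda,F})}{\operatorname{Vol}(F)} \le \left[ \frac{\operatorname{Vol}(E)}{\operatorname{Vol}(F)} \right]^{\lambda},$$ where $\operatorname{Vol}$ denotes $n$-dimensional Lebesgue measure. -/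

import Mathlib

open MeasureTheory Measure

/-- The one-dimensional length of a subset of a segment in `ℝⁿ`, as the one-dimensional Hausdorff
measure (so that the segment with endpoints `a` and `b` has length `dist a b`). -/
noncomputable def segmentLength {n : ℕ} (S : Set (EuclideanSpace ℝ (Fin n))) : ℝ :=
  (hausdorffMeasure 1 : Measure (EuclideanSpace ℝ (Fin n))).real S

/-- The core of `E` in `F` with parameter `lam`: the points `x` of `E` such that `E` fills at least
the proportion `(lam - 1) / lam` of every nondegenerate segment `J` with `x ∈ J ⊆ F`. -/
def core {n : ℕ} (lam : ℝ) (F E : Set (EuclideanSpace ℝ (Fin n))) :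
    Set (EuclideanSpace ℝ (Fin n)) :=
  {x | x ∈ E ∧ ∀ a b : EuclideanSpace ℝ (Fin n), a ≠ b → x ∈ segment ℝ a b → segment ℝ a b ⊆ F →
    (lam - 1) / lam ≤ segmentLength (E ∩ segment ℝ a b) / segmentLength (segment ℝ a b)}

/-!
The proof bisects a hypothetical counterexample down to a needle, a convex body so thin that only
one direction matters, and settles the inequality there by a one-dimensional argument.

*Bisection.* Suppose the core occupies a proportion `c > (vol E / vol F) ^ lam` of `F`. By outer
regularity there is an open `U ⊇ E` whose proportion `p` in `F` still satisfies `p ^ lam < c`.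
Rotating a half-space about a point in a plane and applying the intermediate value theorem, one cuts
a convex body into two bodies in which `U` has the same proportion `p`; in one of them the core
still has at least the proportion `c` (`IsNeedleCandidate.exists_cut`). Cutting through a dense
sequence of points leaves bodies whose intersection projects to a set without interior in the plane,
hence to a subset of a line, so some body in the sequence is narrow in a direction of the plane
(`IsNeedleCandidate.exists_narrow`). Repeating this in planes orthogonal to the directions already
found gives a body that is narrow in all directions of a hyperplane
(`IsNeedleCandidate.exists_needle`). As soon as its fibres are shorter than the distance from `E` to
the complement of `U`, every fibre meeting `E` lies in `U`, so no limit of measures is needed: the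
marginal of the needle itself carries the one-dimensional inequality
(`IsNeedleCandidate.le_rpow_of_narrow`).

*Marginals.* By the Prékopa–Leindler inequality (`prekopa_leindler`) the marginal of a convex body
on a line has a quasiconcave density and log-concave tails (`exists_marginal_density`).

*The line.* Let `μ` be such a probability measure, `A` the complement of `E` and `C` the core. Near
the mode of the density, let `(u, v)` be the gap of `C`. The constraints on `A` seen from `u` and
from `v`, and the monotonicity of the density on both sides of the mode, show that `μ A` is at most
the mass of an explicit distribution that has density `1` on an interval `[s, t]` around the mode,
density `lam⁻¹` next to it, and density `lam⁻¹` outside `C` beyond the gap (`exists_bathtub_bound`).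
Log-concavity of the two tails of `μ` and the weighted inequality between the arithmetic and the
geometric mean then give `μ C ≤ (1 - μ A) ^ lam` (`le_rpow_of_tail_bounds`,
`measureReal_le_one_sub_rpow`).
-/

open scoped ENNReal Pointwise InnerProductSpace RealInnerProductSpace
open Set

/-! ### The Prékopa–Leindler inequality and marginals of log-concave functions -/

theorem IsCompact.volume_add_le_of_add_subset {K L S : Set ℝ} (hK : IsCompact K) (hL : IsCompact L)
    (hK0 : K.Nonempty) (hL0 : L.Nonempty) (h : K + L ⊆ S) : volume K + volume L ≤ volume S := by
  obtain ⟨k, hk, hkmax⟩ := hK.exists_isGreatest hK0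
  obtain ⟨l, hl, hlmin⟩ := hL.exists_isLeast hL0
  have hKm : MeasurableSet ((fun x => x + l) '' K) :=
    (hK.image (by fun_prop)).measurableSet
  have hLm : MeasurableSet ((fun x => k + x) '' L) :=
    (hL.image (by fun_prop)).measurableSet
  have h1 : volume ((fun x => x + l) '' K) = volume K := by
    simp
  have h2 : volume ((fun x => k + x) '' L) = volume L := by
    simp
  -- the two translates meet only in `k + l`
  have h3 : AEDisjoint volume ((fun x => x + l) '' K) ((fun x => k + x) '' L) := by
    refine measure_mono_null (t := {k + l}) ?_ (by simp)
    rintro _ ⟨⟨x, hx, rfl⟩, ⟨y, hy, hxy⟩⟩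
    have := hkmax hx
    have := hlmin hy
    simp only at hxy ⊢
    rw [mem_singleton_iff]
    linarith
  rw [← h1, ← h2, ← measure_union₀ hLm.nullMeasurableSet h3]
  refine measure_mono (union_subset ?_ ?_)
  · rintro _ ⟨x, hx, rfl⟩
    exact h (add_mem_add hx hl)
  · rintro _ ⟨x, hx, rfl⟩
    exact h (add_mem_add hk hx)

/-- One-dimensional Brunn–Minkowski inequality. -/
theorem volume_add_volume_le_of_add_subset {A B S : Set ℝ} (hA : MeasurableSet A)
    (hB : MeasurableSet B) (hA0 : A.Nonempty) (hB0 : B.Nonempty) (h : A + B ⊆ S) :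
    volume A + volume B ≤ volume S := by
  obtain ⟨a, ha⟩ := hA0
  obtain ⟨b, hb⟩ := hB0
  have key : ∀ K ⊆ A, ∀ L ⊆ B, IsCompact K → IsCompact L → volume K + volume L ≤ volume S := by
    intro K hKA L hLB hK hL
    calc volume K + volume L ≤ volume (insert a K) + volume (insert b L) := by
          gcongr <;> exact subset_insert _ _
      _ ≤ volume S := (hK.insert a).volume_add_le_of_add_subset (hL.insert b)
          (insert_nonempty _ _) (insert_nonempty _ _)
          ((add_subset_add (insert_subset ha hKA) (insert_subset hb hLB)).trans h)
  by_contra! hcon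
  by_cases hA0 : volume A = 0
  · rw [hA0, zero_add] at hcon
    obtain ⟨L, hLB, hL, hlt⟩ := hB.exists_lt_isCompact hcon
    exact absurd (key ∅ (empty_subset _) L hLB isCompact_empty hL) (by simpa using hlt)
  by_cases hB0 : volume B = 0
  · rw [hB0, add_zero] at hcon
    obtain ⟨L, hLB, hL, hlt⟩ := hA.exists_lt_isCompact hcon
    exact absurd (key L hLB ∅ (empty_subset _) hL isCompact_empty) (by simpa using hlt)
  obtain ⟨x, hx, y, hy, hxy⟩ := ENNReal.exists_lt_add_of_lt_add hcon hA0 hB0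
  obtain ⟨K, hKA, hK, hKlt⟩ := hA.exists_lt_isCompact hx
  obtain ⟨L, hLB, hL, hLlt⟩ := hB.exists_lt_isCompact hy
  exact absurd (key K hKA L hLB hK hL) (not_le.2 (hxy.trans_le (by gcongr)))

/-- Layer-cake formula for a function bounded by `1`. -/
theorem lintegral_eq_setLIntegral_meas_lt_of_le_one {f : ℝ → ℝ≥0∞} (hf : Measurable f)
    (hf1 : ∀ x, f x ≤ 1) :
    ∫⁻ x, f x = ∫⁻ t in Ioo (0 : ℝ) 1, volume {x | ENNReal.ofReal t < f x} := by
  have h1 : ∫⁻ x, f x = ∫⁻ x, ENNReal.ofReal (f x).toReal := by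
    refine lintegral_congr fun x => ?_
    rw [ENNReal.ofReal_toReal (ne_top_of_le_ne_top ENNReal.one_ne_top (hf1 x))]
  rw [h1, lintegral_eq_lintegral_meas_lt _ (Filter.Eventually.of_forall fun x => by positivity)
    hf.ennreal_toReal.aemeasurable]
  rw [← Ioo_union_Ici_eq_Ioi (zero_lt_one : (0 : ℝ) < 1), lintegral_union measurableSet_Ici]
  · have h2 : ∫⁻ t in Ici (1 : ℝ), volume {x | t < (f x).toReal} = 0 := by
      rw [setLIntegral_congr_fun (g := fun _ => 0) measurableSet_Ici]
      · simp
      · intro t ht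
        have : {x | t < (f x).toReal} = ∅ := by
          ext x
          simp only [mem_ofPred_eq, mem_empty_iff_false, iff_false, not_lt]
          exact (ENNReal.toReal_mono ENNReal.one_ne_top (hf1 x)).trans (by simpa using ht)
        simp [this]
    rw [h2, add_zero]
    refine setLIntegral_congr_fun measurableSet_Ioo fun t ht => ?_
    congr 1
    ext x
    simp only [mem_ofPred_eq]
    rw [ENNReal.ofReal_lt_iff_lt_toReal ht.1.le (ne_top_of_le_ne_top ENNReal.one_ne_top (hf1 x))]
  · rw [disjoint_left]
    intro t ht h
    exact absurd ht.2 (not_lt.2 h)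

/-- The Prékopa–Leindler inequality in additive form, for functions with supremum `1`. -/
theorem add_lintegral_le_of_iSup_eq_one {f g h : ℝ → ℝ≥0∞} (hf : Measurable f) (hg : Measurable g)
    (hh : Measurable h) (hf1 : ⨆ x, f x = 1) (hg1 : ⨆ x, g x = 1) (hh1 : ∀ x, h x ≤ 1) {a b : ℝ}
    (ha : 0 < a) (hb : 0 < b) (hab : a + b = 1)
    (H : ∀ x y, f x ^ a * g y ^ b ≤ h (a * x + b * y)) :
    ENNReal.ofReal a * (∫⁻ x, f x) + ENNReal.ofReal b * (∫⁻ x, g x) ≤ ∫⁻ x, h x := by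
  rw [lintegral_eq_setLIntegral_meas_lt_of_le_one hf (fun x => hf1 ▸ le_iSup f x),
    lintegral_eq_setLIntegral_meas_lt_of_le_one hg (fun x => hg1 ▸ le_iSup g x),
    lintegral_eq_setLIntegral_meas_lt_of_le_one hh hh1,
    ← lintegral_const_mul' _ _ ENNReal.ofReal_ne_top,
    ← lintegral_const_mul' _ _ ENNReal.ofReal_ne_top, ← lintegral_add_left]
  swap
  · refine Measurable.const_mul (Antitone.measurable fun s t hst => measure_mono fun x hx => ?_) _
    exact (ENNReal.ofReal_le_ofReal hst).trans_lt hx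
  refine setLIntegral_mono' measurableSet_Ioo fun t ht => ?_
  have ht1 : ENNReal.ofReal t < 1 := by simpa using ht.2
  have ht0 : 0 < ENNReal.ofReal t := by simpa using ht.1
  have hA : volume (a • {x | ENNReal.ofReal t < f x})
      = ENNReal.ofReal a * volume {x | ENNReal.ofReal t < f x} := by
    rw [addHaar_smul]; simp [abs_of_pos ha]
  have hB : volume (b • {x | ENNReal.ofReal t < g x})
      = ENNReal.ofReal b * volume {x | ENNReal.ofReal t < g x} := by
    rw [addHaar_smul]; simp [abs_of_pos hb]
  rw [← hA, ← hB]
  refine volume_add_volume_le_of_add_subset ((measurableSet_lt measurable_const hf).const_smul₀ a)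
    ((measurableSet_lt measurable_const hg).const_smul₀ b) (Nonempty.smul_set ?_)
    (Nonempty.smul_set ?_) ?_
  · rw [← hf1] at ht1
    exact lt_iSup_iff.1 ht1
  · rw [← hg1] at ht1
    exact lt_iSup_iff.1 ht1
  · rintro _ ⟨_, ⟨x, hx, rfl⟩, _, ⟨y, hy, rfl⟩, rfl⟩
    simp only [mem_ofPred_eq, smul_eq_mul] at hx hy ⊢
    refine lt_of_lt_of_le ?_ (H x y)
    calc ENNReal.ofReal t = ENNReal.ofReal t ^ a * ENNReal.ofReal t ^ b := by
          rw [← ENNReal.rpow_add _ _ ht0.ne' ENNReal.ofReal_ne_top, hab, ENNReal.rpow_one]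
      _ < f x ^ a * g y ^ b :=
          ENNReal.mul_lt_mul (ENNReal.rpow_lt_rpow hx ha) (ENNReal.rpow_lt_rpow hy hb)

theorem ENNReal.rpow_mul_rpow_le_weighted_add (x y : ℝ≥0∞) {a b : ℝ} (ha : 0 < a) (hb : 0 < b)
    (hab : a + b = 1) : x ^ a * y ^ b ≤ ENNReal.ofReal a * x + ENNReal.ofReal b * y := by
  by_cases hx : x = ∞
  · rw [hx, ENNReal.mul_top (by simpa using ha), _root_.top_add]; exact le_top
  by_cases hy : y = ∞
  · rw [hy, ENNReal.mul_top (by simpa using hb), _root_.add_top]; exact le_top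
  lift x to NNReal using hx
  lift y to NNReal using hy
  have := NNReal.geom_mean_le_arith_mean2_weighted ⟨a, ha.le⟩ ⟨b, hb.le⟩ x y
    (by ext; exact hab)
  rw [← ENNReal.coe_rpow_of_nonneg _ ha.le, ← ENNReal.coe_rpow_of_nonneg _ hb.le,
    ENNReal.ofReal, ENNReal.ofReal]
  rw [Real.toNNReal_of_nonneg ha.le, Real.toNNReal_of_nonneg hb.le]
  exact_mod_cast this

/-- For bounded functions the inequality follows from the additive form by normalizing the suprema
to `1` and applying the weighted inequality between arithmetic and geometric means. -/
theorem prekopa_leindler_of_bounded {f g h : ℝ → ℝ≥0∞} (hf : Measurable f) (hg : Measurable g)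
    (hh : Measurable h) (hfb : ⨆ x, f x ≠ ∞) (hgb : ⨆ x, g x ≠ ∞) {a b : ℝ}
    (ha : 0 < a) (hb : 0 < b) (hab : a + b = 1)
    (H : ∀ x y, f x ^ a * g y ^ b ≤ h (a * x + b * y)) :
    (∫⁻ x, f x) ^ a * (∫⁻ x, g x) ^ b ≤ ∫⁻ x, h x := by
  set α := ⨆ x, f x with hα
  set β := ⨆ x, g x with hβ
  by_cases hα0 : α = 0
  · have : ∀ x, f x = 0 := fun x => by simpa using (le_iSup f x).trans hα0.le
    simp [this, ha]
  by_cases hβ0 : β = 0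
  · have : ∀ x, g x = 0 := fun x => by simpa using (le_iSup g x).trans hβ0.le
    simp [this, hb]
  set γ := α ^ a * β ^ b with hγ
  have hγ0 : γ ≠ 0 := by simp [hγ, hα0, hβ0, hfb, hgb, ENNReal.rpow_eq_zero_iff]
  have hγt : γ ≠ ∞ := ENNReal.mul_ne_top (ENNReal.rpow_ne_top_of_nonneg ha.le hfb)
    (ENNReal.rpow_ne_top_of_nonneg hb.le hgb)
  have hγinv : (α⁻¹) ^ a * (β⁻¹) ^ b = γ⁻¹ := by
    rw [hγ, ENNReal.mul_inv (Or.inl ?_) (Or.inl ?_), ENNReal.inv_rpow, ENNReal.inv_rpow]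
    · simp [hα0, hfb, ENNReal.rpow_eq_zero_iff]
    · exact ENNReal.rpow_ne_top_of_nonneg ha.le hfb
  have key := add_lintegral_le_of_iSup_eq_one (f := fun x => α⁻¹ * f x) (g := fun x => β⁻¹ * g x)
    (h := fun x => min (γ⁻¹ * h x) 1) (hf.const_mul _) (hg.const_mul _)
    ((hh.const_mul _).min measurable_const)
    (by rw [← ENNReal.mul_iSup, ← hα, ENNReal.inv_mul_cancel hα0 hfb])
    (by rw [← ENNReal.mul_iSup, ← hβ, ENNReal.inv_mul_cancel hβ0 hgb])
    (fun x => min_le_right _ _) ha hb hab ?_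
  · rw [lintegral_const_mul _ hf, lintegral_const_mul _ hg] at key
    have h1 : (α⁻¹ * ∫⁻ x, f x) ^ a * (β⁻¹ * ∫⁻ x, g x) ^ b ≤ γ⁻¹ * ∫⁻ x, h x := by
      refine (ENNReal.rpow_mul_rpow_le_weighted_add _ _ ha hb hab).trans (key.trans ?_)
      rw [← lintegral_const_mul _ hh]
      exact lintegral_mono fun x => min_le_left _ _
    rw [ENNReal.mul_rpow_of_nonneg _ _ ha.le, ENNReal.mul_rpow_of_nonneg _ _ hb.le,
      mul_mul_mul_comm, hγinv] at h1
    exact (ENNReal.mul_le_mul_iff_right (ENNReal.inv_ne_zero.2 hγt) (ENNReal.inv_ne_top.2 hγ0)).1 h1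
  · intro x y
    refine le_min ?_ ?_
    · rw [ENNReal.mul_rpow_of_nonneg _ _ ha.le, ENNReal.mul_rpow_of_nonneg _ _ hb.le,
        mul_mul_mul_comm, hγinv]
      gcongr
      exact H x y
    · refine mul_le_one' (ENNReal.rpow_le_one ?_ ha.le) (ENNReal.rpow_le_one ?_ hb.le)
      · rw [← ENNReal.inv_mul_cancel hα0 hfb]; gcongr; exact le_iSup f x
      · rw [← ENNReal.inv_mul_cancel hβ0 hgb]; gcongr; exact le_iSup g y

/-- The one-dimensional Prékopa–Leindler inequality. -/
theorem prekopa_leindler {f g h : ℝ → ℝ≥0∞} (hf : Measurable f) (hg : Measurable g)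
    (hh : Measurable h) {a b : ℝ} (ha : 0 < a) (hb : 0 < b) (hab : a + b = 1)
    (H : ∀ x y, f x ^ a * g y ^ b ≤ h (a * x + b * y)) :
    (∫⁻ x, f x) ^ a * (∫⁻ x, g x) ^ b ≤ ∫⁻ x, h x := by
  -- truncate at height `N` to reduce to bounded functions
  have htrunc : ∀ f : ℝ → ℝ≥0∞, Measurable f →
      ∫⁻ x, f x = ⨆ N : ℕ, ∫⁻ x, min (f x) N := by
    intro f hf
    rw [← lintegral_iSup (fun N => hf.min measurable_const)]
    · refine lintegral_congr fun x => ?_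
      rw [← inf_iSup_eq, ENNReal.iSup_natCast, inf_top_eq]
    · intro M N hMN x
      exact min_le_min_left _ (by exact_mod_cast hMN)
  have hrpow : ∀ (c : ℝ), 0 < c → ∀ F : ℕ → ℝ≥0∞, (⨆ N, F N) ^ c = ⨆ N, F N ^ c := by
    intro c hc F
    exact (ENNReal.orderIsoRpow c hc).map_iSup F
  rw [htrunc f hf, htrunc g hg, hrpow a ha, hrpow b hb]
  simp only [ENNReal.iSup_mul, ENNReal.mul_iSup, iSup_le_iff]
  intro M N
  have hb' : ∀ (f : ℝ → ℝ≥0∞) (N : ℕ), ⨆ x, min (f x) (N : ℝ≥0∞) ≠ ∞ := fun f N =>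
    ne_top_of_le_ne_top (ENNReal.natCast_ne_top N) (iSup_le fun x => min_le_right _ _)
  refine prekopa_leindler_of_bounded (hf.min measurable_const) (hg.min measurable_const) hh
    (hb' _ _) (hb' _ _) ha hb hab fun x y => le_trans ?_ (H x y)
  gcongr <;> exact min_le_left _ _

/-- A function with values in `[0, ∞]` is log-concave if `f x ^ a * f y ^ b ≤ f (a • x + b • y)` for
all positive weights `a` and `b` with sum `1`. -/
def IsLogConcave {E : Type*} [AddCommGroup E] [Module ℝ E] (f : E → ℝ≥0∞) : Prop :=
  ∀ x y : E, ∀ a b : ℝ, 0 < a → 0 < b → a + b = 1 → f x ^ a * f y ^ b ≤ f (a • x + b • y)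

theorem IsLogConcave.comp_linearMap {E G : Type*} [AddCommGroup E] [Module ℝ E] [AddCommGroup G]
    [Module ℝ G] {f : G → ℝ≥0∞} (hf : IsLogConcave f) (T : E →ₗ[ℝ] G) :
    IsLogConcave (fun x => f (T x)) := by
  intro x y a b ha hb hab
  simpa using hf (T x) (T y) a b ha hb hab

theorem IsLogConcave.mul {E : Type*} [AddCommGroup E] [Module ℝ E] {f g : E → ℝ≥0∞}
    (hf : IsLogConcave f) (hg : IsLogConcave g) : IsLogConcave (fun x => f x * g x) := by
  intro x y a b ha hb hab
  simp only
  rw [ENNReal.mul_rpow_of_nonneg _ _ ha.le, ENNReal.mul_rpow_of_nonneg _ _ hb.le,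
    mul_mul_mul_comm]
  exact mul_le_mul' (hf x y a b ha hb hab) (hg x y a b ha hb hab)

theorem Convex.isLogConcave_indicator {E : Type*} [AddCommGroup E] [Module ℝ E] {K : Set E}
    (hK : Convex ℝ K) : IsLogConcave (K.indicator (fun _ => (1 : ℝ≥0∞))) := by
  intro x y a b ha hb hab
  by_cases hx : x ∈ K
  · by_cases hy : y ∈ K
    · simp [hx, hy, hK hx hy ha.le hb.le hab]
    · simp [hy, hb]
  · simp [hx, ha]

/-- Integrating out one real variable preserves log-concavity. -/
theorem IsLogConcave.lintegral_prod_real {E : Type*} [AddCommGroup E] [Module ℝ E]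
    {f : E × ℝ → ℝ≥0∞} (hf : IsLogConcave f) (hm : ∀ x, Measurable fun s => f (x, s)) :
    IsLogConcave (fun x => ∫⁻ s, f (x, s)) := by
  intro x y a b ha hb hab
  refine prekopa_leindler (hm _) (hm _) (hm _) ha hb hab fun s t => ?_
  simpa using hf (x, s) (y, t) a b ha hb hab

/-- Integrating out finitely many real variables preserves log-concavity. -/
theorem IsLogConcave.lintegral_prod_pi {k : ℕ} {E : Type*} [AddCommGroup E] [Module ℝ E]
    {f : E × (Fin k → ℝ) → ℝ≥0∞} (hf : IsLogConcave f) (hm : ∀ x, Measurable fun s => f (x, s)) :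
    IsLogConcave (fun x => ∫⁻ s, f (x, s)) := by
  induction k generalizing E with
  | zero =>
    intro x y a b ha hb hab
    have := hf (x, 0) (y, 0) a b ha hb hab
    simp only [Prod.smul_mk, smul_zero, Prod.mk_add_mk, add_zero] at this
    have h0 : ∀ z, ∫⁻ s : Fin 0 → ℝ, f (z, s) = f (z, 0) := fun z => by
      rw [volume_pi, Measure.pi_of_empty _ 0, lintegral_dirac]
    simpa only [h0] using this
  | succ k ih =>
    set e := MeasurableEquiv.piFinSuccAbove (fun _ : Fin (k + 1) => ℝ) 0 with he
    let T : (E × ℝ) × (Fin k → ℝ) →ₗ[ℝ] E × (Fin (k + 1) → ℝ) :=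
      { toFun := fun q => (q.1.1, Fin.cons q.1.2 q.2)
        map_add' := by
          intro p q
          refine Prod.ext rfl ?_
          funext i
          refine Fin.cases ?_ (fun j => ?_) i <;> simp
        map_smul' := by
          intro c q
          refine Prod.ext rfl ?_
          funext i
          refine Fin.cases ?_ (fun j => ?_) i <;> simp }
    have hTm : ∀ x, Measurable fun q : ℝ × (Fin k → ℝ) => f (x, e.symm q) := fun x =>
      (hm x).comp e.symm.measurable
    have hTe : ∀ x s y, f (T ((x, s), y)) = f (x, e.symm (s, y)) := by
      intro x s y
      simp only [T, he, LinearMap.coe_mk, AddHom.coe_mk, MeasurableEquiv.piFinSuccAbove_symm_apply,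
        Fin.insertNthEquiv_zero]
      rfl
    have h1 := ih (hf.comp_linearMap T) (fun x => by
      obtain ⟨x, s⟩ := x
      simp only [hTe]
      exact (hTm x).comp measurable_prodMk_left)
    have h2 := h1.lintegral_prod_real (fun x => by
      simp only [hTe]
      exact (hTm x).lintegral_prod_right')
    have h3 : (fun x => ∫⁻ s, f (x, s)) = fun x => ∫⁻ s, ∫⁻ y, f (T ((x, s), y)) := by
      funext x
      simp only [hTe]
      rw [← lintegral_prod _ (hTm x).aemeasurable]
      exact ((volume_preserving_piFinSuccAbove (fun _ : Fin (k + 1) => ℝ) 0).symm.lintegral_comp_emb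
        e.symm.measurableEmbedding (fun s => f (x, s))).symm
    rw [h3]
    exact h2

/-! ### Densities on the line -/

/-- If a closed set `C` has the property that the proportion of `A` in every interval to the right
of a point of `C` is at most `κ⁻¹`, then the proportion of `A` in the part of `(v, w)` outside `C`
is at most `κ⁻¹`: the components of that part are intervals whose left endpoints lie in `C`. -/
theorem mul_volume_inter_Ioc_le_volume_diff {A C : Set ℝ} {κ : ℝ≥0∞} (hC : IsClosed C)
    (hAC : Disjoint A C) {v w : ℝ} (hv : v ∈ C)
    (h : ∀ x ∈ C, v ≤ x → ∀ w, x ≤ w → κ * volume (A ∩ Icc x w) ≤ ENNReal.ofReal (w - x)) :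
    κ * volume (A ∩ Ioc v w) ≤ volume (Ioc v w \ C) := by
  set O := Ioo v w \ C with hO
  have hOo : IsOpen O := isOpen_Ioo.sdiff hC
  set 𝒮 : Set (Set ℝ) := (fun y => connectedComponentIn O y) '' O
  have hopen : ∀ s ∈ 𝒮, IsOpen s := by
    rintro _ ⟨y, hy, rfl⟩
    exact hOo.connectedComponentIn
  have hdisj : 𝒮.PairwiseDisjoint id := by
    rintro _ ⟨y, hy, rfl⟩ _ ⟨z, hz, rfl⟩ hne
    by_contra hcon
    rw [Function.onFun, id, id, not_disjoint_iff] at hcon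
    obtain ⟨a, ha, hb⟩ := hcon
    exact hne ((connectedComponentIn_eq ha).trans (connectedComponentIn_eq hb).symm)
  have hcount : 𝒮.Countable := hdisj.countable_of_isOpen hopen (by
    rintro _ ⟨y, hy, rfl⟩
    exact ⟨y, mem_connectedComponentIn hy⟩)
  have hU : ⋃₀ 𝒮 = O := by
    apply Subset.antisymm
    · rintro a ⟨_, ⟨y, hy, rfl⟩, ha⟩
      exact connectedComponentIn_subset _ _ ha
    · intro y hy
      exact ⟨_, ⟨y, hy, rfl⟩, mem_connectedComponentIn hy⟩
  have hcomp : ∀ s ∈ 𝒮, κ * volume (A ∩ s) ≤ volume s := by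
    rintro _ ⟨y, hy, rfl⟩
    set s := connectedComponentIn O y with hs
    have hys : y ∈ s := mem_connectedComponentIn hy
    have hsO : s ⊆ O := connectedComponentIn_subset _ _
    have hbelow : BddBelow s := ⟨v, fun a ha => (hsO ha).1.1.le⟩
    have habove : BddAbove s := ⟨w, fun a ha => (hsO ha).1.2.le⟩
    have hconn : IsPreconnected s := isPreconnected_connectedComponentIn
    have hvx : v ≤ sInf s := le_csInf ⟨y, hys⟩ fun a ha => (hsO ha).1.1.le
    have hxy : sInf s ≤ y := csInf_le hbelow hys
    have hyz : y ≤ sSup s := le_csSup habove hys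
    -- otherwise the component `s` would extend beyond its left endpoint
    have hxC : sInf s ∈ C := by
      by_contra hx
      have hvx' : v < sInf s := lt_of_le_of_ne hvx fun h => hx (h ▸ hv)
      have hxO : sInf s ∈ O := ⟨⟨hvx', hxy.trans_lt hy.1.2⟩, hx⟩
      have hins : IsPreconnected (insert (sInf s) s) := hconn.subset_closure (subset_insert _ _)
        (insert_subset (csInf_mem_closure ⟨y, hys⟩ hbelow) subset_closure)
      have hxs : sInf s ∈ s := hins.subset_connectedComponentIn (mem_insert_of_mem _ hys)
        (insert_subset hxO hsO) (mem_insert _ _)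
      obtain ⟨l, hl, hls⟩ := exists_Ioc_subset_of_mem_nhds
        ((hOo.connectedComponentIn (x := y)).mem_nhds hxs) ⟨sInf s - 1, by simp⟩
      have := csInf_le hbelow (hls ⟨left_lt_add_div_two.2 hl, by linarith⟩ : (l + sInf s) / 2 ∈ s)
      linarith
    calc κ * volume (A ∩ s) ≤ κ * volume (A ∩ Icc (sInf s) (sSup s)) := by
          gcongr
          exact subset_Icc_csInf_csSup hbelow habove
      _ ≤ ENNReal.ofReal (sSup s - sInf s) := h _ hxC hvx _ (hxy.trans hyz)
      _ = volume (Ioo (sInf s) (sSup s)) := by rw [Real.volume_Ioo]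
      _ ≤ volume s := measure_mono (IsConnected.Ioo_csInf_csSup_subset ⟨⟨y, hys⟩, hconn⟩
          hbelow habove)
  calc κ * volume (A ∩ Ioc v w) ≤ κ * volume (A ∩ O) := by
        gcongr κ * ?_
        refine (measure_mono (t := A ∩ O ∪ {w}) ?_).trans ((measure_union_le _ _).trans (by simp))
        rintro a ⟨ha, hva, haw⟩
        rcases haw.lt_or_eq with h1 | h1
        · exact Or.inl ⟨ha, ⟨hva, h1⟩, disjoint_left.1 hAC ha⟩
        · exact Or.inr h1
    _ ≤ κ * ∑' s : 𝒮, volume (A ∩ s) := by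
        gcongr κ * ?_
        have := hcount.to_subtype
        rw [← hU, sUnion_eq_iUnion, inter_iUnion]
        exact measure_iUnion_le _
    _ ≤ ∑' s : 𝒮, volume (s : Set ℝ) := by
        rw [← ENNReal.tsum_mul_left]
        exact ENNReal.tsum_le_tsum fun s => hcomp s s.2
    _ = volume O := by
        rw [← hU, measure_sUnion hcount hdisj fun s hs => (hopen s hs).measurableSet]
    _ ≤ volume (Ioc v w \ C) := measure_mono (sdiff_subset_sdiff_left Ioo_subset_Ioc_self)

/-- Integrals of a function that decreases on `(m, ∞)` are monotone in the cumulative mass function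
of the measure, as its superlevel sets in `(m, ∞)` are intervals adjacent to `m`. -/
theorem lintegral_le_lintegral_of_measure_Ioc_le {φ : ℝ → ℝ} (hφm : Measurable φ)
    (hφ0 : ∀ x, 0 ≤ φ x) {m R : ℝ} (hφ : AntitoneOn φ (Ioi m)) (hR : ∀ x, R < x → φ x = 0)
    {ν₁ ν₂ : Measure ℝ} [NullSingletonClass ν₂] (hν₁ : ν₁ (Iic m) = 0)
    (h : ∀ w, m < w → ν₁ (Ioc m w) ≤ ν₂ (Ioc m w)) :
    ∫⁻ x, ENNReal.ofReal (φ x) ∂ν₁ ≤ ∫⁻ x, ENNReal.ofReal (φ x) ∂ν₂ := by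
  rw [lintegral_eq_lintegral_meas_lt _ (Filter.Eventually.of_forall hφ0) hφm.aemeasurable,
    lintegral_eq_lintegral_meas_lt _ (Filter.Eventually.of_forall hφ0) hφm.aemeasurable]
  refine setLIntegral_mono' measurableSet_Ioi fun τ (hτ : 0 < τ) => ?_
  set S := {x | τ < φ x} ∩ Ioi m with hS
  have h1 : ν₁ {x | τ < φ x} ≤ ν₁ S := by
    refine (measure_mono (t := S ∪ Iic m) fun x hx => ?_).trans
      ((measure_union_le _ _).trans (by simp [hν₁]))
    rcases le_or_gt x m with h | h
    · exact Or.inr h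
    · exact Or.inl ⟨hx, h⟩
  refine h1.trans (le_trans ?_ (measure_mono inter_subset_left : ν₂ S ≤ _))
  rcases S.eq_empty_or_nonempty with hS0 | ⟨y, hy⟩
  · simp [hS0]
  have hbdd : BddAbove S := ⟨R, fun x hx => by
    by_contra hcon
    have := hx.1
    rw [mem_ofPred_eq, hR x (not_le.1 hcon)] at this
    linarith⟩
  have hmw : m < sSup S := lt_of_lt_of_le hy.2 (le_csSup hbdd hy)
  calc ν₁ S ≤ ν₁ (Ioc m (sSup S)) := measure_mono fun x hx => ⟨hx.2, le_csSup hbdd hx⟩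
    _ ≤ ν₂ (Ioc m (sSup S)) := h _ hmw
    _ = ν₂ (Ioo m (sSup S)) := (measure_congr Ioo_ae_eq_Ioc).symm
    _ ≤ ν₂ S := measure_mono fun x hx => by
        obtain ⟨z, hz, hxz⟩ := exists_lt_of_lt_csSup ⟨y, hy⟩ hx.2
        exact ⟨lt_of_lt_of_le hz.1 (hφ hx.1 hz.2 hxz.le), hx.1⟩

/-- Bathtub estimate to the right of a mode `m` of a density `φ`. Left of `v` the set `A` is
compared with the mass distribution having density `1` on `(m, m + τ]` and `lam⁻¹` on
`(m + τ, m + ζ]`; right of `v`, where the points of `C` control the proportion of `A`, with the one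
having density `lam⁻¹` outside `C`. -/
theorem lintegral_inter_Ioi_le {φ : ℝ → ℝ} (hφm : Measurable φ)
    (hφ0 : ∀ x, 0 ≤ φ x) {m R : ℝ} (hφ : AntitoneOn φ (Ioi m)) (hR : ∀ x, R < x → φ x = 0)
    {A C : Set ℝ} (hC : IsClosed C) (hAC : Disjoint A C) {lam : ℝ}
    (hlam : 1 < lam) {v τ ζ : ℝ} (hv : v ∈ C)
    (h : ∀ x ∈ C, v ≤ x → ∀ w, x ≤ w →
      ENNReal.ofReal lam * volume (A ∩ Icc x w) ≤ ENNReal.ofReal (w - x))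
    (hτ : 0 ≤ τ) (hτζ : τ ≤ ζ) (hζ : m + ζ ≤ v)
    (hmid : ∀ w, m + τ < w → w ≤ m + ζ →
      volume (A ∩ Icc m w) ≤ ENNReal.ofReal (τ + (w - m - τ) / lam))
    (hr : volume (A ∩ Icc m v) ≤ ENNReal.ofReal (τ + (ζ - τ) / lam)) :
    ∫⁻ x in A ∩ Ioi m, ENNReal.ofReal (φ x) ≤
      (∫⁻ x in Ioc m (m + τ), ENNReal.ofReal (φ x)) +
      ENNReal.ofReal lam⁻¹ * ((∫⁻ x in Ioc (m + τ) (m + ζ), ENNReal.ofReal (φ x)) +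
        ∫⁻ x in Ioi v \ C, ENNReal.ofReal (φ x)) := by
  have hlam0 : 0 < lam := by linarith
  set ν₂ : Measure ℝ := volume.restrict (Ioc m (m + τ)) +
    ENNReal.ofReal lam⁻¹ • (volume.restrict (Ioc (m + τ) (m + ζ)) + volume.restrict (Ioi v \ C))
    with hν₂
  have hint : ∫⁻ x, ENNReal.ofReal (φ x) ∂ν₂ = (∫⁻ x in Ioc m (m + τ), ENNReal.ofReal (φ x)) +
      ENNReal.ofReal lam⁻¹ * ((∫⁻ x in Ioc (m + τ) (m + ζ), ENNReal.ofReal (φ x)) +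
        ∫⁻ x in Ioi v \ C, ENNReal.ofReal (φ x)) := by
    rw [hν₂, lintegral_add_measure, lintegral_smul_measure, lintegral_add_measure, smul_eq_mul]
  rw [← hint]
  have hac : ν₂ ≪ volume := by
    intro s hs
    simp only [hν₂, Measure.add_apply, Measure.smul_apply, smul_eq_mul]
    rw [absolutelyContinuous_of_le restrict_le_self hs,
      absolutelyContinuous_of_le restrict_le_self hs,
      absolutelyContinuous_of_le restrict_le_self hs]
    simp
  have : NullSingletonClass ν₂ := ⟨fun x => hac (by simp)⟩
  refine lintegral_le_lintegral_of_measure_Ioc_le hφm hφ0 hφ hR ?_ ?_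
  · rw [Measure.restrict_apply measurableSet_Iic]
    suffices Iic m ∩ (A ∩ Ioi m) = ∅ by rw [this, measure_empty]
    ext x
    simp only [mem_inter_iff, mem_Iic, mem_Ioi, mem_empty_iff_false, iff_false]
    rintro ⟨h1, _, h2⟩
    linarith
  intro w hw
  have hcoef : ∀ x : ℝ, ENNReal.ofReal (x / lam) = ENNReal.ofReal lam⁻¹ * ENNReal.ofReal x := by
    intro x
    rw [← ENNReal.ofReal_mul (by positivity), div_eq_inv_mul]
  have hL : (volume.restrict (A ∩ Ioi m)) (Ioc m w) ≤ volume (A ∩ Icc m w) := by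
    rw [Measure.restrict_apply measurableSet_Ioc]
    exact measure_mono fun x hx => ⟨hx.2.1, hx.1.1.le, hx.1.2⟩
  have hval : ν₂ (Ioc m w) = volume (Ioc m w ∩ Ioc m (m + τ)) + ENNReal.ofReal lam⁻¹ *
      (volume (Ioc m w ∩ Ioc (m + τ) (m + ζ)) + volume (Ioc m w ∩ (Ioi v \ C))) := by
    simp only [hν₂, Measure.add_apply, Measure.smul_apply, smul_eq_mul,
      Measure.restrict_apply measurableSet_Ioc]
  rw [hval]
  rcases le_or_gt w (m + τ) with h1 | h1
  · have : Ioc m w ∩ Ioc m (m + τ) = Ioc m w := inter_eq_left.2 (Ioc_subset_Ioc_right h1)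
    rw [this]
    refine le_add_right (hL.trans ?_)
    calc volume (A ∩ Icc m w) ≤ volume (Icc m w) := measure_mono inter_subset_right
      _ = volume (Ioc m w) := by simp
  have e1 : volume (Ioc m w ∩ Ioc m (m + τ)) = ENNReal.ofReal τ := by
    rw [inter_eq_right.2 (Ioc_subset_Ioc_right h1.le), Real.volume_Ioc]
    simp
  rw [e1]
  rcases le_or_gt w (m + ζ) with h2 | h2
  · have e2 : Ioc m w ∩ Ioc (m + τ) (m + ζ) = Ioc (m + τ) w := by
      ext x
      simp only [mem_inter_iff, mem_Ioc]
      constructor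
      · rintro ⟨⟨_, h⟩, h', _⟩; exact ⟨h', h⟩
      · rintro ⟨h, h'⟩; exact ⟨⟨by linarith, h'⟩, h, by linarith⟩
    refine hL.trans ((hmid w h1 h2).trans ?_)
    rw [e2, Real.volume_Ioc, ENNReal.ofReal_add hτ (div_nonneg (by linarith) hlam0.le), hcoef]
    gcongr
    refine le_add_right (le_of_eq ?_)
    congr 1
    ring
  have e2 : volume (Ioc m w ∩ Ioc (m + τ) (m + ζ)) = ENNReal.ofReal (ζ - τ) := by
    rw [inter_eq_right.2 (Ioc_subset_Ioc (by linarith) h2.le), Real.volume_Ioc]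
    congr 1
    ring
  rw [e2, mul_add, ← hcoef, ← add_assoc,
    ← ENNReal.ofReal_add hτ (div_nonneg (by linarith) hlam0.le)]
  have hsplit : volume (A ∩ Icc m w) ≤ volume (A ∩ Icc m v) + volume (A ∩ Ioc v w) := by
    refine (measure_mono fun x hx => ?_).trans (measure_union_le _ _)
    rcases le_or_gt x v with h3 | h3
    · exact Or.inl ⟨hx.1, hx.2.1, h3⟩
    · exact Or.inr ⟨hx.1, h3, hx.2.2⟩
  refine hL.trans (hsplit.trans (add_le_add hr ?_))
  have hmain := mul_volume_inter_Ioc_le_volume_diff hC hAC (w := w) hv h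
  have hsub : Ioc v w \ C ⊆ Ioc m w ∩ (Ioi v \ C) := fun x hx =>
    ⟨⟨by linarith [hx.1.1], hx.1.2⟩, hx.1.1, hx.2⟩
  calc volume (A ∩ Ioc v w)
      = ENNReal.ofReal lam⁻¹ * (ENNReal.ofReal lam * volume (A ∩ Ioc v w)) := by
        rw [← mul_assoc, ← ENNReal.ofReal_mul (by positivity), inv_mul_cancel₀ hlam0.ne']
        simp
    _ ≤ _ := by
        gcongr
        exact hmain.trans (measure_mono hsub)

/-- A quasiconcave function with bounded support has a mode. -/
theorem exists_monotoneOn_antitoneOn_of_quasiconcave {φ : ℝ → ℝ} (hφ0 : ∀ x, 0 ≤ φ x)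
    (hφ : ∀ x y z, x ≤ y → y ≤ z → min (φ x) (φ z) ≤ φ y) {L R : ℝ} (hLR : L ≤ R)
    (hsupp : ∀ x, x ∉ Icc L R → φ x = 0) :
    ∃ m ∈ Icc L R, MonotoneOn φ (Iio m) ∧ AntitoneOn φ (Ioi m) := by
  by_cases hz : ∀ x, φ x = 0
  · exact ⟨L, ⟨le_rfl, hLR⟩, fun x _ y _ _ => by simp [hz], fun x _ y _ _ => by simp [hz]⟩
  push Not at hz
  obtain ⟨x₀, hx₀⟩ := hz
  have hx₀' : 0 < φ x₀ := lt_of_le_of_ne (hφ0 x₀) hx₀.symm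
  -- a point in the closure of all nonempty superlevel sets is a mode
  let T := {τ : ℝ // 0 ≤ τ ∧ ∃ x, τ < φ x}
  have hsub : ∀ τ : T, {x | τ.1 < φ x} ⊆ Icc L R := by
    intro τ x hx
    by_contra hcon
    rw [mem_ofPred_eq, hsupp x hcon] at hx
    linarith [τ.2.1]
  have hne : Nonempty T := ⟨⟨0, le_rfl, x₀, hx₀'⟩⟩
  obtain ⟨m, hm⟩ := IsCompact.nonempty_iInter_of_directed_nonempty_isCompact_isClosed
    (fun τ : T => closure {x | τ.1 < φ x}) (by
      intro σ τ
      rcases le_total σ.1 τ.1 with h | h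
      · exact ⟨τ, closure_mono fun x hx => lt_of_le_of_lt h hx, subset_rfl⟩
      · exact ⟨σ, subset_rfl, closure_mono fun x hx => lt_of_le_of_lt h hx⟩)
    (fun τ => (show ({x | τ.1 < φ x} : Set ℝ).Nonempty from τ.2.2).closure)
    (fun τ => isCompact_Icc.of_isClosed_subset isClosed_closure
      (closure_minimal (hsub τ) isClosed_Icc))
    (fun τ => isClosed_closure)
  rw [mem_iInter] at hm
  refine ⟨m, closure_minimal (hsub ⟨0, le_rfl, x₀, hx₀'⟩) isClosed_Icc (hm _), ?_, ?_⟩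
  · intro x hx y hy hxy
    by_contra! hcon
    obtain ⟨z, hz, hz'⟩ := mem_closure_iff.1 (hm ⟨φ y, hφ0 y, x, hcon⟩) (Ioi y) isOpen_Ioi hy
    exact absurd (hφ x y z hxy (le_of_lt hz)) (not_le.2 (lt_min hcon hz'))
  · intro x hx y hy hxy
    by_contra! hcon
    obtain ⟨z, hz, hz'⟩ := mem_closure_iff.1 (hm ⟨φ x, hφ0 x, y, hcon⟩) (Iio x) isOpen_Iio hx
    exact absurd (hφ z x y (le_of_lt hz) hxy) (not_le.2 (lt_min hz' hcon))

/-- Comparison of the growth of a monotone log-concave function on the intervals `[u, u₁]` and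
`[s, t]`, the first of which lies to the left of the second and is at least `c` times as long. -/
theorem IsLogConcave.mul_rpow_le_mul_rpow {P : ℝ → ℝ≥0∞} (hP : IsLogConcave P) (hmono : Monotone P)
    (hfin : ∀ x, P x ≠ ∞) {u u₁ s t c : ℝ} (hc : 0 < c) (h1 : u ≤ u₁) (h2 : u₁ ≤ s) (h3 : s ≤ t)
    (h : c * (t - s) ≤ u₁ - u) : P u * P t ^ c ≤ P u₁ * P s ^ c := by
  by_cases h0 : P u = 0
  · simp [h0]
  rcases eq_or_lt_of_le (h1.trans (h2.trans h3)) with hut | hut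
  · have e1 : u₁ = u := by linarith
    have e2 : s = t := by linarith
    rw [e1, e2]
  have hpos : ∀ x, u ≤ x → P x ≠ 0 := fun x hx hx0 => h0 (le_zero_iff.1 (hx0 ▸ hmono hx))
  have hP' : ∀ a b : ℝ, 0 ≤ a → 0 ≤ b → a + b = 1 → P u ^ a * P t ^ b ≤ P (a * u + b * t) := by
    intro a b ha hb hab
    rcases ha.eq_or_lt with rfl | ha
    · obtain rfl : b = 1 := by linarith
      simp
    rcases hb.eq_or_lt with rfl | hb
    · obtain rfl : a = 1 := by linarith
      simp
    exact hP u t a b ha hb hab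
  have htu : 0 < t - u := by linarith
  -- write `u₁` and `s` as convex combinations of `u` and `t`
  set α := (u₁ - u) / (t - u) with hα
  set β := (s - u) / (t - u) with hβ
  have hα0 : 0 ≤ α := div_nonneg (by linarith) htu.le
  have hβ0 : 0 ≤ β := div_nonneg (by linarith) htu.le
  have hα1 : α ≤ 1 := (div_le_one htu).2 (by linarith)
  have hβ1 : β ≤ 1 := (div_le_one htu).2 (by linarith)
  have hαu : (1 - α) * u + α * t = u₁ := by rw [hα]; field_simp; ring
  have hβu : (1 - β) * u + β * t = s := by rw [hβ]; field_simp; ring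
  -- this makes the total exponent of `P u` below at most `1`, so part of it may be moved to `P t`
  have hαβ : c * (1 - β) ≤ α := by
    have : 1 - β = (t - s) / (t - u) := by rw [hβ]; field_simp; ring
    rw [this, hα, ← mul_div_assoc]
    gcongr
  have i1 := hP' (1 - α) α (by linarith) hα0 (by ring)
  have i2 := hP' (1 - β) β (by linarith) hβ0 (by ring)
  rw [hαu] at i1
  rw [hβu] at i2
  have hut0 := hpos u le_rfl
  have htt0 := hpos t hut.le
  calc P u * P t ^ c
      = P u ^ ((1 - α) + (1 - β) * c) * P u ^ (α - (1 - β) * c) * P t ^ c := by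
        rw [← ENNReal.rpow_add _ _ hut0 (hfin u)]
        congr 1
        rw [show (1 - α) + (1 - β) * c + (α - (1 - β) * c) = 1 by ring, ENNReal.rpow_one]
    _ ≤ P u ^ ((1 - α) + (1 - β) * c) * P t ^ (α - (1 - β) * c) * P t ^ c := by
        gcongr
        · linarith
        · exact hmono hut.le
    _ = (P u ^ (1 - α) * P t ^ α) * (P u ^ (1 - β) * P t ^ β) ^ c := by
        rw [ENNReal.mul_rpow_of_nonneg _ _ hc.le, ← ENNReal.rpow_mul, ← ENNReal.rpow_mul,
          mul_mul_mul_comm, ← ENNReal.rpow_add _ _ hut0 (hfin u),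
          ← ENNReal.rpow_add _ _ htt0 (hfin t), mul_assoc,
          ← ENNReal.rpow_add _ _ htt0 (hfin t)]
        congr 2
        ring
    _ ≤ P u₁ * P s ^ c := by gcongr

/-- The numerical inequality that closes the one-dimensional argument. Here `p ≤ p₁ ≤ X` are the
values of the distribution function at `u ≤ u₁ ≤ s`, and `q ≤ q₁ ≤ Y` those of the upper tail at
`v ≥ v₁ ≥ t`; `a` and `c` are the measures of `A` and `C`. -/
theorem le_rpow_of_tail_bounds {lam a c p q p₁ q₁ X Y : ℝ} (hlam : 1 < lam) (hp : 0 ≤ p)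
    (hq : 0 ≤ q) (hc : 0 ≤ c) (hpp : p ≤ p₁) (hqq : q ≤ q₁) (hpX : p₁ ≤ X) (hqY : q₁ ≤ Y)
    (hXY : X + Y ≤ 1) (hcpq : c ≤ p + q)
    (hP : p * (1 - Y) ^ (lam - 1) ≤ p₁ * X ^ (lam - 1))
    (hG : q * (1 - X) ^ (lam - 1) ≤ q₁ * Y ^ (lam - 1))
    (ha : a ≤ (1 - X - Y) + lam⁻¹ * ((X - p₁) + p + ((Y - q₁) + q) - c)) :
    c ≤ (1 - a) ^ lam := by
  have hlam0 : 0 < lam := by linarith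
  set S := X + Y with hS
  set z := p₁ + q₁ with hz
  have aux : ∀ X Y p p₁ : ℝ, 0 ≤ p → p ≤ p₁ → p₁ ≤ X → 0 ≤ Y → X + Y ≤ 1 →
      p * (1 - Y) ^ (lam - 1) ≤ p₁ * X ^ (lam - 1) → p ≤ p₁ * (X + Y) ^ (lam - 1) := by
    intro X Y p p₁ hp hpp hpX hY hXY hP
    rcases eq_or_lt_of_le (show Y ≤ 1 by linarith) with h1 | h1
    · have : p = 0 := by linarith
      rw [this]
      exact mul_nonneg (by linarith) (Real.rpow_nonneg (by linarith) _)
    · have hY1 : 0 < 1 - Y := by linarith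
      have h2 : X / (1 - Y) ≤ X + Y := by
        rw [div_le_iff₀ hY1]
        nlinarith
      have h3 : p ≤ p₁ * (X / (1 - Y)) ^ (lam - 1) := by
        rw [Real.div_rpow (by linarith) hY1.le, ← mul_div_assoc,
          le_div_iff₀ (Real.rpow_pos_of_pos hY1 _)]
        exact hP
      refine h3.trans (mul_le_mul_of_nonneg_left (Real.rpow_le_rpow ?_ h2 (by linarith))
        (by linarith))
      exact div_nonneg (by linarith) hY1.le
  have hp' := aux X Y p p₁ hp hpp hpX (by linarith) hXY hP
  have hq' := aux Y X q q₁ hq hqq hqY (by linarith) (by linarith) hG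
  rw [add_comm Y X] at hq'
  have hS0 : 0 ≤ S := by linarith
  have hz0 : 0 ≤ z := by linarith
  have hg : p + q ≤ z * S ^ (lam - 1) := by
    rw [hz, add_mul]; linarith
  set g := p + q with hgdef
  have hg0 : 0 ≤ g := by linarith
  have hg1 : g ≤ 1 := by linarith
  -- weighted AM-GM for `S` and `z`
  have amgm : g ^ lam⁻¹ ≤ (1 - lam⁻¹) * S + lam⁻¹ * z := by
    have hinv : lam⁻¹ < 1 := inv_lt_one_of_one_lt₀ hlam
    have h1 := Real.geom_mean_le_arith_mean2_weighted (w₁ := 1 - lam⁻¹) (w₂ := lam⁻¹)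
      (by linarith) (by positivity) hS0 hz0 (by ring)
    refine le_trans ?_ h1
    calc g ^ lam⁻¹ ≤ (z * S ^ (lam - 1)) ^ lam⁻¹ := Real.rpow_le_rpow hg0 hg (by positivity)
      _ = S ^ (1 - lam⁻¹) * z ^ lam⁻¹ := by
        rw [Real.mul_rpow hz0 (Real.rpow_nonneg hS0 _), ← Real.rpow_mul hS0, mul_comm]
        congr 2
        field_simp
  -- `x ↦ x ^ lam⁻¹ - lam⁻¹ * x` is increasing on `[0, 1]`
  have hmono : c ^ lam⁻¹ - lam⁻¹ * c ≤ g ^ lam⁻¹ - lam⁻¹ * g := by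
    rcases hg0.eq_or_lt with h0 | h0
    · have : c = g := by linarith
      rw [this]
    have hρ0 : 0 ≤ c / g := div_nonneg hc h0.le
    have hρ1 : c / g ≤ 1 := (div_le_one h0).2 hcpq
    have hinv : lam⁻¹ ≤ 1 := (inv_lt_one_of_one_lt₀ hlam).le
    have hb : (c / g) ^ lam⁻¹ ≤ 1 + lam⁻¹ * (c / g - 1) := by
      have := rpow_one_add_le_one_add_mul_self (s := c / g - 1) (p := lam⁻¹) (by linarith)
        (by positivity) hinv
      simpa using this
    have hgg : g ≤ g ^ lam⁻¹ := Real.self_le_rpow_of_le_one hg0 hg1 hinv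
    have hcg : c = g * (c / g) := by field_simp
    have e : c ^ lam⁻¹ = g ^ lam⁻¹ * (c / g) ^ lam⁻¹ := by
      rw [← Real.mul_rpow h0.le hρ0, ← hcg]
    have h3 : lam⁻¹ * (1 - c / g) ≤ 1 - (c / g) ^ lam⁻¹ := by linarith
    have h4 : g * (lam⁻¹ * (1 - c / g)) ≤ g ^ lam⁻¹ * (1 - (c / g) ^ lam⁻¹) :=
      mul_le_mul hgg h3 (mul_nonneg (by positivity) (by linarith)) (by positivity)
    have h5 : g * (lam⁻¹ * (1 - c / g)) = lam⁻¹ * g - lam⁻¹ * c := by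
      field_simp
    rw [e]
    linarith
  have hfin : c ^ lam⁻¹ ≤ 1 - a := by
    have : lam⁻¹ * ((X - p₁) + p + ((Y - q₁) + q) - c)
      = lam⁻¹ * S - lam⁻¹ * z + lam⁻¹ * g - lam⁻¹ * c := by rw [hS, hz, hgdef]; ring
    rw [this] at ha
    linarith
  calc c = (c ^ lam⁻¹) ^ lam := by rw [← Real.rpow_mul hc, inv_mul_cancel₀ hlam0.ne', Real.rpow_one]
    _ ≤ (1 - a) ^ lam := Real.rpow_le_rpow (by positivity) hfin hlam0.le

/-- The reflected form of `lintegral_inter_Ioi_le`. -/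
theorem lintegral_inter_Iio_le {φ : ℝ → ℝ} (hφm : Measurable φ)
    (hφ0 : ∀ x, 0 ≤ φ x) {m L : ℝ} (hφ : MonotoneOn φ (Iio m)) (hL : ∀ x, x < L → φ x = 0)
    {A C : Set ℝ} (hC : IsClosed C) (hAC : Disjoint A C) {lam : ℝ}
    (hlam : 1 < lam) {u σ ξ : ℝ} (hu : u ∈ C)
    (h : ∀ x ∈ C, x ≤ u → ∀ w, w ≤ x →
      ENNReal.ofReal lam * volume (A ∩ Icc w x) ≤ ENNReal.ofReal (x - w))
    (hσ : 0 ≤ σ) (hσξ : σ ≤ ξ) (hξ : u ≤ m - ξ)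
    (hmid : ∀ w, w < m - σ → m - ξ ≤ w →
      volume (A ∩ Icc w m) ≤ ENNReal.ofReal (σ + (m - w - σ) / lam))
    (hr : volume (A ∩ Icc u m) ≤ ENNReal.ofReal (σ + (ξ - σ) / lam)) :
    ∫⁻ x in A ∩ Iio m, ENNReal.ofReal (φ x) ≤
      (∫⁻ x in Ico (m - σ) m, ENNReal.ofReal (φ x)) +
      ENNReal.ofReal lam⁻¹ * ((∫⁻ x in Ico (m - ξ) (m - σ), ENNReal.ofReal (φ x)) +
        ∫⁻ x in Iio u \ C, ENNReal.ofReal (φ x)) := by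
  have hint : ∀ s : Set ℝ, ∫⁻ x in Neg.neg ⁻¹' s, ENNReal.ofReal (φ (-x)) =
      ∫⁻ x in s, ENNReal.ofReal (φ x) := fun s =>
    (measurePreserving_neg volume).setLIntegral_comp_preimage_emb
      (MeasurableEquiv.neg ℝ).measurableEmbedding (fun x => ENNReal.ofReal (φ x)) s
  have hvol : ∀ w x, volume (Neg.neg ⁻¹' A ∩ Icc w x) = volume (A ∩ Icc (-x) (-w)) := by
    intro w x
    rw [← measure_preimage_neg volume (A ∩ Icc (-x) (-w))]
    congr 1
    ext y
    simp [and_comm]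
  have key := lintegral_inter_Ioi_le (φ := fun x => φ (-x)) (m := -m) (R := -L) (v := -u) (τ := σ)
    (ζ := ξ) (A := Neg.neg ⁻¹' A) (C := Neg.neg ⁻¹' C) (hφm.comp measurable_neg) (fun x => hφ0 _)
    (fun x hx y hy hxy => hφ (by simp at hy ⊢; linarith) (by simp at hx ⊢; linarith) (by linarith))
    (fun x hx => hL _ (by linarith)) (hC.preimage continuous_neg) (hAC.preimage _) hlam
    (by simpa using hu)
    (fun x hx hx' w hw => by
      rw [hvol]
      refine (h (-x) hx (by linarith) (-w) (by linarith)).trans (le_of_eq ?_)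
      congr 1; ring)
    hσ hσξ (by linarith)
    (fun w hw hw' => by
      rw [hvol, neg_neg]
      refine (hmid (-w) (by linarith) (by linarith)).trans (le_of_eq ?_)
      congr 3; ring)
    (by rw [hvol, neg_neg, neg_neg]; exact hr)
  have e1 : Neg.neg ⁻¹' A ∩ Ioi (-m) = Neg.neg ⁻¹' (A ∩ Iio m) := by
    ext x; simp
  have e2 : Ioc (-m) (-m + σ) = Neg.neg ⁻¹' (Ico (m - σ) m) := by
    ext x
    simp only [mem_Ioc, mem_preimage, mem_Ico]
    constructor <;> rintro ⟨h1, h2⟩ <;> constructor <;> linarith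
  have e3 : Ioc (-m + σ) (-m + ξ) = Neg.neg ⁻¹' (Ico (m - ξ) (m - σ)) := by
    ext x
    simp only [mem_Ioc, mem_preimage, mem_Ico]
    constructor <;> rintro ⟨h1, h2⟩ <;> constructor <;> linarith
  have e4 : Ioi (-u) \ Neg.neg ⁻¹' C = Neg.neg ⁻¹' (Iio u \ C) := by
    ext x; simp
  rwa [e1, e2, e3, e4, hint, hint, hint, hint] at key

/-- Parameters of the extremal mass distribution on one side of the mode. Here `x` and `y` are the
distances from the mode to the adjacent points of the core on the other and on this side, and `d`
and `r` are the lengths that `A` occupies on these two intervals. -/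
theorem exists_bathtub_parameters {lam x y d r : ℝ} (hlam : 1 < lam) (hd : lam * d ≤ x)
    (hr0 : 0 ≤ r) (hr : lam * r ≤ y) :
    ∃ τ ζ : ℝ, 0 ≤ τ ∧ τ ≤ ζ ∧ ζ ≤ y ∧ (τ < ζ → x - lam * d ≤ (lam - 1) * τ) ∧
      r ≤ τ + (ζ - τ) / lam ∧ τ ≤ r ∧ (lam - 1) * τ ≤ x - lam * d ∧
      (ζ = τ ∨ ζ = lam * (d + r) - x) := by
  have h1 : 0 < lam - 1 := by linarith
  have hry : r ≤ y := by nlinarith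
  rcases le_total r ((x - lam * d) / (lam - 1)) with h | h
  · have h' : (lam - 1) * r ≤ x - lam * d := by
      rw [le_div_iff₀ h1] at h; linarith
    exact ⟨r, r, hr0, le_rfl, hry, fun h => absurd h (lt_irrefl _), by simp, le_rfl, h', Or.inl rfl⟩
  · set τ := (x - lam * d) / (lam - 1) with hτ
    have hτe : (lam - 1) * τ = x - lam * d := by rw [hτ]; field_simp
    have hτ0 : 0 ≤ τ := div_nonneg (by linarith) h1.le
    refine ⟨τ, lam * (d + r) - x, hτ0, ?_, by linarith, fun _ => hτe.ge, ?_, h, hτe.le, Or.inr rfl⟩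
    · nlinarith
    · refine le_of_eq ?_
      have : lam * (d + r) - x - τ = lam * (r - τ) := by linarith
      rw [this, mul_div_assoc, mul_comm, div_mul_cancel₀ _ (by linarith)]
      ring

/-! ### The one-dimensional inequality -/

/-- The extremal configuration: `A` has at most the measure of the mass distribution that has density
`1` on an interval `[s, t]` around the mode, density `lam⁻¹` on `[u₁, s]` and `[t, v₁]`, density `0`
on the rest of the gap `(u, v)` of `C` containing the mode, and density `lam⁻¹` on the part of the
complement of `C` outside this gap. -/
theorem exists_bathtub_bound {φ : ℝ → ℝ} (hφm : Measurable φ) (hφ0 : ∀ x, 0 ≤ φ x)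
    (hφ : ∀ x y z, x ≤ y → y ≤ z → min (φ x) (φ z) ≤ φ y) {L R : ℝ} (hLR : L ≤ R)
    (hsupp : ∀ x, x ∉ Icc L R → φ x = 0) {μ : Measure ℝ} [NullSingletonClass μ]
    (hμ : μ = volume.withDensity fun x => ENNReal.ofReal (φ x)) [IsProbabilityMeasure μ]
    {A C : Set ℝ} (hA : MeasurableSet A) (hC : IsClosed C) (hAC : Disjoint A C) {lam : ℝ}
    (hlam : 1 < lam) (h : ∀ x ∈ C, ∀ w, lam * volume.real (A ∩ uIcc x w) ≤ |w - x|)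
    {f₁ f₂ : ℝ} (hf₁ : f₁ ∈ C) (hf₁L : f₁ ≤ L) (hf₂ : f₂ ∈ C) (hf₂R : R ≤ f₂) :
    ∃ u u₁ s t v₁ v : ℝ, u ≤ u₁ ∧ u₁ ≤ s ∧ s ≤ t ∧ t ≤ v₁ ∧ v₁ ≤ v ∧
      (lam - 1) * (t - s) ≤ u₁ - u ∧ (lam - 1) * (t - s) ≤ v - v₁ ∧ C ⊆ Iic u ∪ Ici v ∧
      μ.real A ≤ μ.real (Icc s t) + lam⁻¹ * (μ.real (Ico u₁ s) + μ.real (Iio u \ C) +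
        (μ.real (Ioc t v₁) + μ.real (Ioi v \ C))) := by
  have hlam0 : 0 < lam := by linarith
  have hμs : ∀ s, MeasurableSet s → ∫⁻ x in s, ENNReal.ofReal (φ x) = μ s := fun s hs => by
    rw [hμ, withDensity_apply _ hs]
  obtain ⟨m, hm, hmono, hanti⟩ :=
    exists_monotoneOn_antitoneOn_of_quasiconcave hφ0 hφ hLR hsupp
  -- `u` and `v` are the points of `C` adjacent to the mode
  obtain ⟨u, ⟨huC, hum⟩, humax⟩ : ∃ u ∈ C ∩ Iic m, ∀ x ∈ C ∩ Iic m, x ≤ u :=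
    ⟨_, (hC.inter isClosed_Iic).csSup_mem ⟨f₁, hf₁, hf₁L.trans hm.1⟩ ⟨m, fun x hx => hx.2⟩,
      fun x hx => le_csSup ⟨m, fun x hx => hx.2⟩ hx⟩
  obtain ⟨v, ⟨hvC, hmv⟩, hvmin⟩ : ∃ v ∈ C ∩ Ici m, ∀ x ∈ C ∩ Ici m, v ≤ x :=
    ⟨_, (hC.inter isClosed_Ici).csInf_mem ⟨f₂, hf₂, hm.2.trans hf₂R⟩ ⟨m, fun x hx => hx.2⟩,
      fun x hx => csInf_le ⟨m, fun x hx => hx.2⟩ hx⟩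
  rw [mem_Iic] at hum
  rw [mem_Ici] at hmv
  have hfin : ∀ a b, volume (A ∩ Icc a b) ≠ ∞ := fun a b =>
    ne_top_of_le_ne_top (by simp) (measure_mono inter_subset_right : _ ≤ volume (Icc a b))
  have hright : ∀ x ∈ C, ∀ w, x ≤ w → lam * volume.real (A ∩ Icc x w) ≤ w - x := by
    intro x hx w hw
    have := h x hx w
    rwa [uIcc_of_le hw, abs_of_nonneg (by linarith)] at this
  have hleft : ∀ x ∈ C, ∀ w, w ≤ x → lam * volume.real (A ∩ Icc w x) ≤ x - w := by
    intro x hx w hw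
    have := h x hx w
    rwa [uIcc_of_ge hw, abs_of_nonpos (by linarith), neg_sub] at this
  have hE : ∀ a b c, lam * volume.real (A ∩ Icc a b) ≤ c →
      ENNReal.ofReal lam * volume (A ∩ Icc a b) ≤ ENNReal.ofReal c := by
    intro a b c hc
    rw [← ofReal_measureReal (hfin a b), ← ENNReal.ofReal_mul hlam0.le]
    exact ENNReal.ofReal_le_ofReal hc
  have hE' : ∀ a b c, volume.real (A ∩ Icc a b) ≤ c →
      volume (A ∩ Icc a b) ≤ ENNReal.ofReal c := by
    intro a b c hc
    rw [← ofReal_measureReal (hfin a b)]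
    exact ENNReal.ofReal_le_ofReal hc
  have hadd : ∀ a b c, a ≤ b → b ≤ c → volume.real (A ∩ Icc a b) + volume.real (A ∩ Icc b c) ≤
      volume.real (A ∩ Icc a c) := by
    intro a b c hab hbc
    rw [← measureReal_union₀ (hA.inter measurableSet_Icc).nullMeasurableSet ?_ (hfin _ _)
      (hfin _ _), ← inter_union_distrib_left, Icc_union_Icc_eq_Icc hab hbc]
    refine measure_mono_null (t := {b}) ?_ (by simp)
    rintro x ⟨⟨_, _, h1⟩, _, h2, _⟩
    exact le_antisymm h1 h2
  set d := volume.real (A ∩ Icc u m) with hd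
  set r := volume.real (A ∩ Icc m v) with hr
  have hd0 : 0 ≤ d := measureReal_nonneg
  have hr0 : 0 ≤ r := measureReal_nonneg
  have hdx := hright u huC m hum
  have hry := hleft v hvC m hmv
  obtain ⟨τ, ζ, hτ0, hτζ, hζ, hτt, hrτ, hτr, hτx, hζc⟩ :=
    exists_bathtub_parameters hlam hdx hr0 hry
  obtain ⟨σ, ξ, hσ0, hσξ, hξ, hσt, hdσ, hσd, hσy, hξc⟩ :=
    exists_bathtub_parameters hlam hry hd0 hdx
  -- right of the mode, the constraint on `A` seen from `u` gives the cumulative bound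
  have key1 := lintegral_inter_Ioi_le hφm hφ0 hanti
    (fun x hx => hsupp x fun hx' => absurd hx'.2 (not_le.2 hx)) hC hAC hlam hvC
    (fun x hx _ w hw => hE _ _ _ (hright x hx w hw)) hτ0 hτζ (by linarith)
    (fun w hw hw' => hE' _ _ _ (by
      have h1 := hτt (by linarith)
      have h2 := hright u huC w (by linarith)
      have h3 := hadd u m w hum (by linarith)
      have h4 : lam * (d + volume.real (A ∩ Icc m w)) ≤ w - u :=
        (mul_le_mul_of_nonneg_left h3 hlam0.le).trans h2
      rw [← sub_le_iff_le_add', le_div_iff₀ hlam0]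
      linarith)) (hE' _ _ _ hrτ)
  -- left of the mode, the constraint seen from `v` does
  have key2 := lintegral_inter_Iio_le hφm hφ0 hmono
    (fun x hx => hsupp x fun hx' => absurd hx'.1 (not_le.2 hx)) hC hAC hlam huC
    (fun x hx _ w hw => hE _ _ _ (hleft x hx w hw)) hσ0 hσξ (by linarith)
    (fun w hw hw' => hE' _ _ _ (by
      have h1 := hσt (by linarith)
      have h2 := hleft v hvC w (by linarith)
      have h3 := hadd w m v (by linarith) hmv
      have h4 : lam * (volume.real (A ∩ Icc w m) + r) ≤ v - w :=
        (mul_le_mul_of_nonneg_left h3 hlam0.le).trans h2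
      rw [← sub_le_iff_le_add', le_div_iff₀ hlam0]
      linarith)) (hE' _ _ _ hdσ)
  rw [hμs _ (hA.inter measurableSet_Ioi), hμs _ measurableSet_Ioc, hμs _ measurableSet_Ioc,
    hμs _ (measurableSet_Ioi.diff hC.measurableSet)] at key1
  rw [hμs _ (hA.inter measurableSet_Iio), hμs _ measurableSet_Ico, hμs _ measurableSet_Ico,
    hμs _ (measurableSet_Iio.diff hC.measurableSet)] at key2
  have toR : ∀ a b c d : Set ℝ, μ a ≤ μ b + ENNReal.ofReal lam⁻¹ * (μ c + μ d) →
      μ.real a ≤ μ.real b + lam⁻¹ * (μ.real c + μ.real d) := by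
    intro a b c d h
    have := ENNReal.toReal_mono (by finiteness) h
    rwa [ENNReal.toReal_add (by finiteness) (by finiteness), ENNReal.toReal_mul,
      ENNReal.toReal_add (by finiteness) (by finiteness),
      ENNReal.toReal_ofReal (by positivity)] at this
  have key1 := toR _ _ _ _ key1
  have key2 := toR _ _ _ _ key2
  have hAle : μ.real A ≤ μ.real (A ∩ Iio m) + μ.real (A ∩ Ioi m) := by
    have h1 : μ.real A ≤ μ.real (A ∩ Iio m ∪ A ∩ Ioi m) + μ.real {m} := by
      refine (measureReal_mono fun x hx => ?_).trans (measureReal_union_le _ _)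
      rcases lt_trichotomy x m with h | h | h
      · exact Or.inl (Or.inl ⟨hx, h⟩)
      · exact Or.inr h
      · exact Or.inl (Or.inr ⟨hx, h⟩)
    have h2 := measureReal_union_le (μ := μ) (A ∩ Iio m) (A ∩ Ioi m)
    have h3 : μ.real {m} = 0 := by simp [Measure.real]
    linarith
  have hξx : (lam - 1) * ((m + τ) - (m - σ)) ≤ (m - ξ) - u := by
    rcases hξc with h | h <;> rw [h] <;> nlinarith
  have hζy : (lam - 1) * ((m + τ) - (m - σ)) ≤ v - (m + ζ) := by
    rcases hζc with h | h <;> rw [h] <;> nlinarith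
  have hst : μ.real (Ico (m - σ) m) + μ.real (Ioc m (m + τ)) ≤ μ.real (Icc (m - σ) (m + τ)) := by
    rw [← measureReal_union ?_ measurableSet_Ioc]
    · refine measureReal_mono (union_subset ?_ ?_)
      · exact fun x hx => ⟨hx.1, by linarith [hx.2]⟩
      · exact fun x hx => ⟨by linarith [hx.1], hx.2⟩
    · rw [disjoint_left]
      exact fun x hx hx' => absurd hx.2 (not_lt.2 hx'.1.le)
  refine ⟨u, m - ξ, m - σ, m + τ, m + ζ, v, by linarith, by linarith, by linarith, by linarith,
    by linarith, hξx, hζy, fun x hx => ?_, ?_⟩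
  · rcases le_total x m with hxm | hxm
    · exact Or.inl (humax x ⟨hx, hxm⟩)
    · exact Or.inr (hvmin x ⟨hx, hxm⟩)
  · rw [mul_add]
    linarith

/-- The one-dimensional inequality, when `C` has points on both sides of the support. -/
theorem measureReal_le_one_sub_rpow_of_mem {φ : ℝ → ℝ} (hφm : Measurable φ) (hφ0 : ∀ x, 0 ≤ φ x)
    (hφ : ∀ x y z, x ≤ y → y ≤ z → min (φ x) (φ z) ≤ φ y) {L R : ℝ} (hLR : L ≤ R)
    (hsupp : ∀ x, x ∉ Icc L R → φ x = 0) {μ : Measure ℝ}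
    (hμ : μ = volume.withDensity fun x => ENNReal.ofReal (φ x)) [IsProbabilityMeasure μ]
    (hP : IsLogConcave fun t => μ (Iic t)) (hG : IsLogConcave fun t => μ (Ici t))
    {A C : Set ℝ} (hA : MeasurableSet A) (hC : IsClosed C) (hAC : Disjoint A C) {lam : ℝ}
    (hlam : 1 < lam) (h : ∀ x ∈ C, ∀ w, lam * volume.real (A ∩ uIcc x w) ≤ |w - x|)
    {f₁ f₂ : ℝ} (hf₁ : f₁ ∈ C) (hf₁L : f₁ ≤ L) (hf₂ : f₂ ∈ C) (hf₂R : R ≤ f₂) :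
    μ.real C ≤ (1 - μ.real A) ^ lam := by
  have hlam0 : 0 < lam := by linarith
  have : NullSingletonClass μ := by
    rw [hμ]; infer_instance
  obtain ⟨u, u₁, s, t, v₁, v, huu, hus, hst, htv, hvv, hu, hv, hCuv, hAle⟩ :=
    exists_bathtub_bound hφm hφ0 hφ hLR hsupp hμ hA hC hAC hlam h hf₁ hf₁L hf₂ hf₂R
  -- the distribution function
  set H : ℝ → ℝ := fun x => μ.real (Iic x) with hH
  have hIoc : ∀ a b, a ≤ b → μ.real (Ioc a b) = H b - H a := by
    intro a b hab
    rw [← Iic_sdiff_Iic, measureReal_sdiff (Iic_subset_Iic.2 hab) measurableSet_Iic]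
  have hIco : ∀ a b, a ≤ b → μ.real (Ico a b) = H b - H a := by
    intro a b hab
    rw [← hIoc a b hab]
    exact measureReal_congr Ico_ae_eq_Ioc
  have hIci : ∀ a, μ.real (Ici a) = 1 - H a := by
    intro a
    rw [hH, ← probReal_compl_eq_one_sub measurableSet_Iic, compl_Iic]
    exact (measureReal_congr Ioi_ae_eq_Ici).symm
  have hHmono : ∀ a b, a ≤ b → H a ≤ H b := fun a b hab => measureReal_mono (Iic_subset_Iic.2 hab)
  have hIoiC : μ.real (C ∩ Ici v) + μ.real (Ioi v \ C) ≤ 1 - H v := by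
    rw [← hIci, inter_comm, ← measureReal_inter_add_sdiff (s := Ici v) hC.measurableSet]
    gcongr
    · exact measure_ne_top _ _
    · exact Ioi_subset_Ici_self
  have hIioC : μ.real (C ∩ Iic u) + μ.real (Iio u \ C) ≤ H u := by
    rw [hH, inter_comm]
    simp only
    rw [← measureReal_inter_add_sdiff (s := Iic u) hC.measurableSet]
    gcongr
    · exact measure_ne_top _ _
    · exact Iio_subset_Iic_self
  have hcuv : μ.real C ≤ μ.real (C ∩ Iic u) + μ.real (C ∩ Ici v) := by
    refine (measureReal_mono fun x hx => ?_).trans (measureReal_union_le _ _)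
    exact (hCuv hx).imp (fun h => ⟨hx, h⟩) (fun h => ⟨hx, h⟩)
  have hIcc : μ.real (Icc s t) = H t - H s := by
    rw [← hIoc s t hst]
    exact (measureReal_congr Ioc_ae_eq_Icc).symm
  rw [hIcc, hIco _ _ hus, hIoc _ _ htv] at hAle
  have hPr := hP.mul_rpow_le_mul_rpow (fun a b hab => measure_mono (Iic_subset_Iic.2 hab))
    (fun x => measure_ne_top _ _) (sub_pos.2 hlam) huu hus hst hu
  have hGr := (hG.comp_linearMap (-LinearMap.id)).mul_rpow_le_mul_rpow
    (fun a b hab => measure_mono (Ici_subset_Ici.2 (by simpa using hab)))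
    (fun x => measure_ne_top _ _) (u := -v) (u₁ := -v₁) (s := -t) (t := -s)
    (sub_pos.2 hlam) (by linarith) (by linarith) (by linarith) (by linarith)
  have toR' : ∀ a b c d : Set ℝ, μ a * μ b ^ (lam - 1) ≤ μ c * μ d ^ (lam - 1) →
      μ.real a * μ.real b ^ (lam - 1) ≤ μ.real c * μ.real d ^ (lam - 1) := by
    intro a b c d h
    have := ENNReal.toReal_mono (ENNReal.mul_ne_top (by finiteness)
      (ENNReal.rpow_ne_top_of_nonneg (by linarith) (by finiteness))) h
    rwa [ENNReal.toReal_mul, ENNReal.toReal_mul, ← ENNReal.toReal_rpow, ← ENNReal.toReal_rpow]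
      at this
  have hPr := toR' _ _ _ _ hPr
  have hGr := toR' _ _ _ _ hGr
  simp only [LinearMap.neg_apply, LinearMap.id_apply, neg_neg, hIci] at hGr
  have hle1 : ∀ x, H x ≤ 1 := fun x => measureReal_le_one
  have h1 : 0 ≤ μ.real (Iio u \ C) := measureReal_nonneg
  have h2 : 0 ≤ μ.real (Ioi v \ C) := measureReal_nonneg
  refine le_rpow_of_tail_bounds (X := H s) (Y := 1 - H t) (p := H u) (q := 1 - H v)
    (p₁ := H u₁) (q₁ := 1 - H v₁) hlam measureReal_nonneg (by linarith [hle1 v])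
    measureReal_nonneg (hHmono _ _ huu) (by linarith [hHmono v₁ v hvv])
    (hHmono _ _ hus) (by linarith [hHmono t v₁ htv]) (by linarith [hHmono s t hst])
    (by linarith) ?_ hGr ?_
  · rw [sub_sub_cancel]; exact hPr
  · refine hAle.trans ?_
    rw [show 1 - H s - (1 - H t) = H t - H s by ring]
    gcongr
    linarith

/-- The one-dimensional case: if `μ` is a probability measure on the line with quasiconcave density
and log-concave tails, and every segment starting at a point of `C` has at most the proportion
`lam⁻¹` of its length in `A`, then `μ C ≤ (1 - μ A) ^ lam`. -/
theorem measureReal_le_one_sub_rpow {φ : ℝ → ℝ} (hφm : Measurable φ) (hφ0 : ∀ x, 0 ≤ φ x)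
    (hφ : ∀ x y z, x ≤ y → y ≤ z → min (φ x) (φ z) ≤ φ y) {L R : ℝ} (hLR : L ≤ R)
    (hsupp : ∀ x, x ∉ Icc L R → φ x = 0) {μ : Measure ℝ}
    (hμ : μ = volume.withDensity fun x => ENNReal.ofReal (φ x)) [IsProbabilityMeasure μ]
    (hP : IsLogConcave fun t => μ (Iic t)) (hG : IsLogConcave fun t => μ (Ici t))
    {A C : Set ℝ} (hA : MeasurableSet A) (hAsub : A ⊆ Icc L R) (hC : IsClosed C)
    (hAC : Disjoint A C) {lam : ℝ}
    (hlam : 1 < lam) (h : ∀ x ∈ C, ∀ w, lam * volume.real (A ∩ uIcc x w) ≤ |w - x|) :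
    μ.real C ≤ (1 - μ.real A) ^ lam := by
  -- adjoin to `C` two points so far away that the condition holds there automatically
  set D := lam * (R - L) + 1 with hD
  have hD0 : 0 < D := by nlinarith
  set C' := insert (L - D) (insert (R + D) C) with hC'
  have hvolA : ∀ s, volume.real (A ∩ s) ≤ R - L := by
    intro s
    calc volume.real (A ∩ s) ≤ volume.real (Icc L R) :=
          measureReal_mono (inter_subset_left.trans hAsub) (by simp)
      _ = R - L := by simp [Measure.real, hLR]
  have hnear : ∀ f w, (A ∩ uIcc f w).Nonempty → (∀ a ∈ Icc L R, D ≤ |a - f|) →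
      lam * volume.real (A ∩ uIcc f w) ≤ |w - f| := by
    rintro f w ⟨a, haA, haf⟩ hf
    have h1 := hf a (hAsub haA)
    have h2 := abs_sub_left_of_mem_uIcc haf
    have h3 := mul_le_mul_of_nonneg_left (hvolA (uIcc f w)) (by linarith : 0 ≤ lam)
    linarith
  have hall : ∀ x ∈ C', ∀ w, lam * volume.real (A ∩ uIcc x w) ≤ |w - x| := by
    intro x hx w
    rcases (A ∩ uIcc x w).eq_empty_or_nonempty with hem | hem
    · simp [hem]
    rcases hx with rfl | rfl | hx
    · refine hnear _ w hem fun a ha => ?_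
      rw [abs_of_nonneg] <;> linarith [ha.1]
    · refine hnear _ w hem fun a ha => ?_
      rw [abs_of_nonpos] <;> linarith [ha.2]
    · exact h x hx w
  have hAC' : Disjoint A C' := by
    rw [disjoint_left] at hAC ⊢
    rintro a ha (rfl | rfl | h)
    · linarith [(hAsub ha).1]
    · linarith [(hAsub ha).2]
    · exact hAC ha h
  refine (measureReal_mono ?_ (measure_ne_top _ _)).trans
    (measureReal_le_one_sub_rpow_of_mem hφm hφ0 hφ hLR hsupp hμ hP hG hA (C := C')
      (isClosed_singleton.union (isClosed_singleton.union hC)) hAC' hlam hall (f₁ := L - D)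
      (f₂ := R + D)
      (mem_insert _ _) (by linarith) (mem_insert_of_mem _ (mem_insert _ _)) (by linarith))
  exact (subset_insert _ _).trans (subset_insert _ _)

/-! ### Bisection into needles -/

section Bisection

variable {V : Type*} [NormedAddCommGroup V] [InnerProductSpace ℝ V]

/-- The unit vector at angle `θ` in the plane with orthonormal basis `e₁`, `e₂`. -/
noncomputable def planeDir (e₁ e₂ : V) (θ : ℝ) : V := Real.cos θ • e₁ + Real.sin θ • e₂

theorem planeDir_ne_zero {e₁ e₂ : V} (h₁ : ‖e₁‖ = 1) (h₂ : ‖e₂‖ = 1) (h₁₂ : ⟪e₁, e₂⟫ = 0) (θ : ℝ) :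
    planeDir e₁ e₂ θ ≠ 0 := by
  intro h
  have h3 : ⟪planeDir e₁ e₂ θ, planeDir e₁ e₂ θ⟫ = 0 := by rw [h, inner_zero_left]
  simp only [planeDir, inner_add_left, inner_add_right, inner_smul_left, inner_smul_right,
    real_inner_self_eq_norm_sq, h₁, h₂, h₁₂, real_inner_comm e₁ e₂] at h3
  have := Real.cos_sq_add_sin_sq θ
  simp at h3
  nlinarith

/-- The half-space through `z` with inner normal at angle `θ`. -/
def planeHalfSpace (e₁ e₂ z : V) (θ : ℝ) : Set V := {x | 0 ≤ ⟪planeDir e₁ e₂ θ, x - z⟫}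

theorem isClosed_planeHalfSpace (e₁ e₂ z : V) (θ : ℝ) : IsClosed (planeHalfSpace e₁ e₂ z θ) :=
  isClosed_le continuous_const (by fun_prop)

theorem convex_planeHalfSpace (e₁ e₂ z : V) (θ : ℝ) : Convex ℝ (planeHalfSpace e₁ e₂ z θ) := by
  intro x hx y hy a b ha hb hab
  simp only [planeHalfSpace, mem_ofPred_eq] at *
  have : a • x + b • y - z = a • (x - z) + b • (y - z) := by
    rw [smul_sub, smul_sub, sub_add_sub_comm, ← add_smul, hab, one_smul]
  rw [this, inner_add_right, inner_smul_right, inner_smul_right]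
  positivity

theorem mem_planeHalfSpace_add_pi {e₁ e₂ z x : V} {θ : ℝ} :
    x ∈ planeHalfSpace e₁ e₂ z (θ + Real.pi) ↔ ⟪planeDir e₁ e₂ θ, x - z⟫ ≤ 0 := by
  have : planeDir e₁ e₂ (θ + Real.pi) = - planeDir e₁ e₂ θ := by
    simp [planeDir, Real.cos_add_pi, Real.sin_add_pi]
    abel
  simp [planeHalfSpace, this]

variable [FiniteDimensional ℝ V] [MeasurableSpace V] [BorelSpace V]

/-- A convex body `K` of positive volume in which `U` has exactly the proportion `p` of the volume
and `C` at least the proportion `c`. The set `C` need not be measurable. -/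
structure IsNeedleCandidate (U C : Set V) (p c : ℝ) (K : Set V) : Prop where
  isCompact : IsCompact K
  convex : Convex ℝ K
  pos : 0 < volume.real K
  prop_eq : volume.real (U ∩ K) = p * volume.real K
  le_prop : c * volume.real K ≤ volume.real (C ∩ K)

theorem volume_inner_sub_eq_zero {w : V} (hw : w ≠ 0) (z : V) :
    volume {x : V | ⟪w, x - z⟫ = 0} = 0 := by
  have h1 : {x : V | ⟪w, x - z⟫ = 0} = (fun x => x + (-z)) ⁻¹' ((ℝ ∙ w)ᗮ : Submodule ℝ V) := by
    ext x
    simp [Submodule.mem_orthogonal_singleton_iff_inner_right, sub_eq_add_neg]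
  rw [h1, measure_preimage_add_right]
  refine addHaar_submodule _ _ fun h => hw ?_
  have : w ∈ (ℝ ∙ w)ᗮ := h ▸ Submodule.mem_top
  rwa [Submodule.mem_orthogonal_singleton_iff_inner_right, inner_self_eq_zero] at this

theorem continuous_measureReal_planeHalfSpace {e₁ e₂ : V} (h₁ : ‖e₁‖ = 1) (h₂ : ‖e₂‖ = 1)
    (h₁₂ : ⟪e₁, e₂⟫ = 0) (z : V) {ν : Measure V} [IsFiniteMeasure ν] (hν : ν ≪ volume) :
    Continuous fun θ => ν.real (planeHalfSpace e₁ e₂ z θ) := by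
  have hmeas : ∀ θ, MeasurableSet (planeHalfSpace e₁ e₂ z θ) := fun θ =>
    (isClosed_planeHalfSpace e₁ e₂ z θ).measurableSet
  simp_rw [← integral_indicator_one (μ := ν) (hmeas _)]
  rw [continuous_iff_continuousAt]
  intro θ₀
  refine continuousAt_of_dominated (bound := fun _ => 1) ?_ ?_ (integrable_const _) ?_
  · exact Filter.Eventually.of_forall fun θ =>
      (measurable_const.indicator (hmeas θ)).aestronglyMeasurable
  · refine Filter.Eventually.of_forall fun θ => Filter.Eventually.of_forall fun x => ?_
    by_cases hx : x ∈ planeHalfSpace e₁ e₂ z θ <;> simp [hx]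
  · have hnull : ∀ᵐ x ∂ν, ⟪planeDir e₁ e₂ θ₀, x - z⟫ ≠ 0 := by
      rw [ae_iff]
      simp only [ne_eq, not_not]
      exact hν (volume_inner_sub_eq_zero (planeDir_ne_zero h₁ h₂ h₁₂ θ₀) z)
    filter_upwards [hnull] with x hx
    have hc : Continuous fun θ => ⟪planeDir e₁ e₂ θ, x - z⟫ := by
      unfold planeDir
      fun_prop
    rcases lt_or_gt_of_ne hx with h | h
    · refine (continuousAt_const (y := (0 : ℝ))).congr ?_
      filter_upwards [hc.continuousAt.eventually_lt continuousAt_const h] with θ hθ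
      rw [indicator_of_notMem]
      simpa [planeHalfSpace] using hθ
    · refine (continuousAt_const (y := (1 : ℝ))).congr ?_
      filter_upwards [continuousAt_const.eventually_lt hc.continuousAt h] with θ hθ
      rw [indicator_of_mem]
      · rfl
      · exact hθ.le

theorem measureReal_planeHalfSpace_add_pi {e₁ e₂ : V} (h₁ : ‖e₁‖ = 1) (h₂ : ‖e₂‖ = 1)
    (h₁₂ : ⟪e₁, e₂⟫ = 0) (z : V) {ν : Measure V} [IsFiniteMeasure ν] (hν : ν ≪ volume) (θ : ℝ) :
    ν.real (planeHalfSpace e₁ e₂ z θ) + ν.real (planeHalfSpace e₁ e₂ z (θ + Real.pi)) =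
      ν.real univ := by
  have hU : planeHalfSpace e₁ e₂ z θ ∪ planeHalfSpace e₁ e₂ z (θ + Real.pi) = univ := by
    ext x
    simp only [mem_union, mem_planeHalfSpace_add_pi, mem_univ, iff_true]
    exact le_total 0 ⟪planeDir e₁ e₂ θ, x - z⟫
  rw [← measureReal_union₀ (isClosed_planeHalfSpace e₁ e₂ z _).measurableSet.nullMeasurableSet ?_,
    hU]
  refine measure_mono_null (fun x hx => ?_)
    (hν (volume_inner_sub_eq_zero (planeDir_ne_zero h₁ h₂ h₁₂ θ) z))
  exact le_antisymm (mem_planeHalfSpace_add_pi.1 hx.2) hx.1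

/-- Rotating a half-space about `z` gives, by the intermediate value theorem, a bisection into two
bodies with the same proportion of `U`; in one of them the proportion of `C` has not decreased. -/
theorem IsNeedleCandidate.exists_cut {U C K : Set V} {p c : ℝ} (hK : IsNeedleCandidate U C p c K)
    {e₁ e₂ : V} (h₁ : ‖e₁‖ = 1) (h₂ : ‖e₂‖ = 1) (h₁₂ : ⟪e₁, e₂⟫ = 0) (z : V) :
    ∃ θ, IsNeedleCandidate U C p c (K ∩ planeHalfSpace e₁ e₂ z θ) := by
  have hKm := hK.isCompact.measurableSet
  have hKfin : volume K ≠ ∞ := hK.isCompact.measure_lt_top.ne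
  have : IsFiniteMeasure (volume.restrict K) := ⟨by simpa using hK.isCompact.measure_lt_top⟩
  have : IsFiniteMeasure (volume.restrict (U ∩ K)) :=
    ⟨by simpa using (measure_mono inter_subset_right).trans_lt hK.isCompact.measure_lt_top⟩
  have hac : ∀ s : Set V, volume.restrict s ≪ volume := fun s =>
    absolutelyContinuous_of_le restrict_le_self
  have hr : ∀ (s : Set V) θ, (volume.restrict s).real (planeHalfSpace e₁ e₂ z θ) =
      volume.real (s ∩ planeHalfSpace e₁ e₂ z θ) := fun s θ => by
    rw [measureReal_restrict_apply (isClosed_planeHalfSpace e₁ e₂ z θ).measurableSet, inter_comm]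
  set f : ℝ → ℝ := fun θ => volume.real (U ∩ K ∩ planeHalfSpace e₁ e₂ z θ) -
    p * volume.real (K ∩ planeHalfSpace e₁ e₂ z θ) with hf
  have hfc : Continuous f := by
    simp only [hf, ← hr]
    exact (continuous_measureReal_planeHalfSpace h₁ h₂ h₁₂ z (hac _)).sub
      (continuous_const.mul (continuous_measureReal_planeHalfSpace h₁ h₂ h₁₂ z (hac _)))
  have hsplitK : ∀ θ, volume.real (K ∩ planeHalfSpace e₁ e₂ z θ) +
      volume.real (K ∩ planeHalfSpace e₁ e₂ z (θ + Real.pi)) = volume.real K := by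
    intro θ
    have := measureReal_planeHalfSpace_add_pi h₁ h₂ h₁₂ z (hac K) θ
    rwa [hr, hr, measureReal_restrict_apply_univ] at this
  have hsplitU : ∀ θ, volume.real (U ∩ K ∩ planeHalfSpace e₁ e₂ z θ) +
      volume.real (U ∩ K ∩ planeHalfSpace e₁ e₂ z (θ + Real.pi)) = volume.real (U ∩ K) := by
    intro θ
    have := measureReal_planeHalfSpace_add_pi h₁ h₂ h₁₂ z (hac (U ∩ K)) θ
    rwa [hr, hr, measureReal_restrict_apply_univ] at this
  -- opposite half-spaces have opposite excess of `U`, so `f` changes sign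
  have hfpi : ∀ θ, f (θ + Real.pi) = - f θ := by
    intro θ
    have h1 := hsplitK θ
    have h2 := hsplitU θ
    rw [hK.prop_eq, ← h1] at h2
    simp only [hf]
    linarith
  obtain ⟨θ, hθ⟩ : ∃ θ, f θ = 0 := by
    rcases le_total (f 0) 0 with h | h
    · exact mem_range_of_exists_le_of_exists_ge hfc ⟨0, h⟩ ⟨0 + Real.pi, by rw [hfpi]; linarith⟩
    · exact mem_range_of_exists_le_of_exists_ge hfc ⟨0 + Real.pi, by rw [hfpi]; linarith⟩ ⟨0, h⟩
  have hθ' : f (θ + Real.pi) = 0 := by rw [hfpi, hθ, neg_zero]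
  have hC : volume.real (C ∩ K) ≤ volume.real (C ∩ (K ∩ planeHalfSpace e₁ e₂ z θ)) +
      volume.real (C ∩ (K ∩ planeHalfSpace e₁ e₂ z (θ + Real.pi))) := by
    have hfin : volume (C ∩ (K ∩ planeHalfSpace e₁ e₂ z θ) ∪
        C ∩ (K ∩ planeHalfSpace e₁ e₂ z (θ + Real.pi))) ≠ ∞ :=
      ne_top_of_le_ne_top hKfin (measure_mono (union_subset
        (inter_subset_right.trans inter_subset_left) (inter_subset_right.trans inter_subset_left)))
    refine (measureReal_mono (fun x hx => ?_) hfin).trans (measureReal_union_le _ _)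
    rcases le_total 0 ⟪planeDir e₁ e₂ θ, x - z⟫ with h | h
    · exact Or.inl ⟨hx.1, hx.2, h⟩
    · exact Or.inr ⟨hx.1, hx.2, mem_planeHalfSpace_add_pi.2 h⟩
  have hgood : ∀ θ, f θ = 0 → 0 < volume.real (K ∩ planeHalfSpace e₁ e₂ z θ) →
      c * volume.real (K ∩ planeHalfSpace e₁ e₂ z θ) ≤
        volume.real (C ∩ (K ∩ planeHalfSpace e₁ e₂ z θ)) →
      ∃ θ, IsNeedleCandidate U C p c (K ∩ planeHalfSpace e₁ e₂ z θ) := by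
    intro θ h1 h2 h3
    refine ⟨θ, hK.isCompact.inter_right (isClosed_planeHalfSpace _ _ _ _),
      hK.convex.inter (convex_planeHalfSpace _ _ _ _), h2, ?_, h3⟩
    rw [← inter_assoc]
    exact sub_eq_zero.1 h1
  by_contra hcon
  have key : ∀ θ, f θ = 0 → volume.real (C ∩ (K ∩ planeHalfSpace e₁ e₂ z θ)) ≤
      c * volume.real (K ∩ planeHalfSpace e₁ e₂ z θ) ∧
      (0 < volume.real (K ∩ planeHalfSpace e₁ e₂ z θ) →
        volume.real (C ∩ (K ∩ planeHalfSpace e₁ e₂ z θ)) <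
          c * volume.real (K ∩ planeHalfSpace e₁ e₂ z θ)) := by
    intro θ hθ
    have h0 : 0 ≤ volume.real (K ∩ planeHalfSpace e₁ e₂ z θ) := measureReal_nonneg
    have hlt : 0 < volume.real (K ∩ planeHalfSpace e₁ e₂ z θ) →
        volume.real (C ∩ (K ∩ planeHalfSpace e₁ e₂ z θ)) <
          c * volume.real (K ∩ planeHalfSpace e₁ e₂ z θ) := fun h => by
      by_contra h'
      exact hcon (hgood θ hθ h (not_lt.1 h'))
    refine ⟨?_, hlt⟩
    rcases h0.eq_or_lt with h | h
    · rw [← h, mul_zero, h]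
      exact measureReal_mono inter_subset_right
        (ne_top_of_le_ne_top hKfin (measure_mono inter_subset_left))
    · exact (hlt h).le
  have k1 := key θ hθ
  have k2 := key _ hθ'
  have hs := hsplitK θ
  have hle := hK.le_prop
  have hpos := hK.pos
  rw [← hs, mul_add] at hle
  rcases lt_or_ge 0 (volume.real (K ∩ planeHalfSpace e₁ e₂ z θ)) with h | h
  · linarith [k1.2 h, k2.1]
  · linarith [k1.1, k2.2 (by linarith)]

theorem IsNeedleCandidate.exists_seq_cut {U C K : Set V} {p c : ℝ}
    (hK : IsNeedleCandidate U C p c K)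
    {e₁ e₂ : V} (h₁ : ‖e₁‖ = 1) (h₂ : ‖e₂‖ = 1) (h₁₂ : ⟪e₁, e₂⟫ = 0)
    (z : ℕ → V) :
    ∃ Q : ℕ → Set V, Q 0 = K ∧ (∀ j, IsNeedleCandidate U C p c (Q j)) ∧
      ∀ j, Q (j + 1) ⊆ Q j ∧ ∃ θ, Q (j + 1) ⊆ planeHalfSpace e₁ e₂ (z j) θ := by
  choose θ hθ using fun (Q : {Q : Set V // IsNeedleCandidate U C p c Q}) (z : V) =>
    Q.2.exists_cut h₁ h₂ h₁₂ z
  let Q : ℕ → {Q : Set V // IsNeedleCandidate U C p c Q} := fun j =>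
    Nat.rec ⟨K, hK⟩ (fun j Q => ⟨_, hθ Q (z j)⟩) j
  exact ⟨fun j => (Q j).1, rfl, fun j => (Q j).2, fun j =>
    ⟨inter_subset_left, θ (Q j) (z j), inter_subset_right⟩⟩

/-- Cutting a body by half-spaces through a dense set of points, with normals in a plane, makes it
arbitrarily narrow in some direction of that plane: the projection of the intersection of all the
bodies to the plane has empty interior, so it lies on a line. -/
theorem IsNeedleCandidate.exists_narrow {U C K : Set V} {p c : ℝ} (hK : IsNeedleCandidate U C p c K)
    {e₁ e₂ : V} (h₁ : ‖e₁‖ = 1) (h₂ : ‖e₂‖ = 1) (h₁₂ : ⟪e₁, e₂⟫ = 0) {δ : ℝ}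
    (hδ : 0 < δ) :
    ∃ Q ⊆ K, IsNeedleCandidate U C p c Q ∧ ∃ α β : ℝ, (α ≠ 0 ∨ β ≠ 0) ∧
      ∀ x ∈ Q, ∀ y ∈ Q, ⟪α • e₁ + β • e₂, x - y⟫ ≤ δ * ‖α • e₁ + β • e₂‖ := by
  obtain ⟨Q, hQ0, hQ, hcut⟩ := hK.exists_seq_cut h₁ h₂ h₁₂ (TopologicalSpace.denseSeq V)
  have hanti : Antitone Q := antitone_nat_of_succ_le fun j => (hcut j).1
  have h₂₁ : ⟪e₂, e₁⟫ = 0 := by rw [real_inner_comm]; exact h₁₂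
  let T : V →L[ℝ] ℝ × ℝ := (innerSL ℝ e₁).prod (innerSL ℝ e₂)
  have hT : ∀ x, T x = (⟪e₁, x⟫, ⟪e₂, x⟫) := fun x => rfl
  set Qi := ⋂ j, Q j with hQi
  have hconv : Convex ℝ (T '' Qi) :=
    (convex_iInter fun j => (hQ j).convex).linear_image T.toLinearMap
  have hint : interior (T '' Qi) = ∅ := by
    rw [eq_empty_iff_forall_notMem]
    intro q hq
    have hne : (T ⁻¹' interior (T '' Qi)).Nonempty := by
      refine ⟨q.1 • e₁ + q.2 • e₂, ?_⟩
      rw [mem_preimage, hT]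
      simpa [inner_add_right, inner_smul_right, h₁, h₂, h₁₂, h₂₁] using hq
    obtain ⟨j, hj⟩ := (TopologicalSpace.denseRange_denseSeq V).exists_mem_open
      (isOpen_interior.preimage T.continuous) hne
    -- the projection of `z` would lie on the boundary of a half-plane containing `T '' Qi`
    set z := TopologicalSpace.denseSeq V j
    obtain ⟨θ, hθ⟩ := (hcut j).2
    have hcont : Filter.Tendsto (fun η : ℝ => T (z - η • planeDir e₁ e₂ θ)) (nhdsWithin 0 (Ioi 0))
        (nhds (T z)) := by
      have : Continuous fun η : ℝ => T (z - η • planeDir e₁ e₂ θ) := by fun_prop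
      simpa using (this.tendsto 0).mono_left nhdsWithin_le_nhds
    obtain ⟨η, hη, hη0⟩ := ((hcont.eventually (isOpen_interior.mem_nhds hj)).and
      self_mem_nhdsWithin).exists
    obtain ⟨x, hx, hxT⟩ := interior_subset hη
    have hxθ := hθ (mem_iInter.1 hx (j + 1))
    rw [hT, hT, Prod.mk.injEq] at hxT
    have hdir : ∀ y, ⟪planeDir e₁ e₂ θ, y⟫ = Real.cos θ * ⟪e₁, y⟫ + Real.sin θ * ⟪e₂, y⟫ := by
      intro y
      simp [planeDir, inner_add_left, inner_smul_left]
    have h0 : 0 < ⟪planeDir e₁ e₂ θ, planeDir e₁ e₂ θ⟫ :=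
      real_inner_self_pos.2 (planeDir_ne_zero h₁ h₂ h₁₂ θ)
    have h3 : ⟪planeDir e₁ e₂ θ, x⟫ = ⟪planeDir e₁ e₂ θ, z - η • planeDir e₁ e₂ θ⟫ := by
      rw [hdir x, hdir (z - _), hxT.1, hxT.2]
    rw [planeHalfSpace, mem_ofPred_eq, inner_sub_right, h3, inner_sub_right, inner_smul_right]
      at hxθ
    have := mul_pos hη0 h0
    linarith
  obtain ⟨α, β, hαβ, hc⟩ : ∃ α β : ℝ, (α ≠ 0 ∨ β ≠ 0) ∧
      ∃ κ, ∀ x ∈ Qi, ⟪α • e₁ + β • e₂, x⟫ = κ := by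
    rcases Qi.eq_empty_or_nonempty with he | ⟨x₀, hx₀⟩
    · exact ⟨1, 0, Or.inl one_ne_zero, 0, by simp [he]⟩
    have hspan : (affineSpan ℝ (T '' Qi)).direction < ⊤ := by
      rw [lt_top_iff_ne_top]
      intro htop
      have := (AffineSubspace.direction_eq_top_iff_of_nonempty
        ((affineSpan_nonempty ℝ).2 ⟨_, mem_image_of_mem T hx₀⟩)).1 htop
      rw [← hconv.interior_nonempty_iff_affineSpan_eq_top, hint] at this
      exact not_nonempty_empty this
    obtain ⟨f, hf0, hf⟩ := Submodule.exists_le_ker_of_lt_top _ hspan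
    have hfe : ∀ q : ℝ × ℝ, f q = q.1 * f (1, 0) + q.2 * f (0, 1) := by
      intro q
      conv_lhs => rw [show q = q.1 • ((1 : ℝ), (0 : ℝ)) + q.2 • ((0 : ℝ), (1 : ℝ)) by ext <;> simp]
      rw [map_add, map_smul, map_smul, smul_eq_mul, smul_eq_mul]
    have hval : ∀ x, ⟪f (1, 0) • e₁ + f (0, 1) • e₂, x⟫ = f (T x) := by
      intro x
      rw [hfe (T x), hT, inner_add_left, real_inner_smul_left, real_inner_smul_left]
      ring
    refine ⟨f (1, 0), f (0, 1), ?_, f (T x₀), fun x hx => ?_⟩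
    · by_contra! hcon
      refine hf0 (LinearMap.ext fun q => ?_)
      rw [hfe, hcon.1, hcon.2]
      simp
    · rw [hval, ← sub_eq_zero, ← map_sub]
      exact hf (AffineSubspace.vsub_mem_direction
        (subset_affineSpan ℝ _ (mem_image_of_mem T hx))
        (subset_affineSpan ℝ _ (mem_image_of_mem T hx₀)))
  obtain ⟨κ, hκ⟩ := hc
  set w := α • e₁ + β • e₂ with hw
  have hw0 : 0 < ‖w‖ := by
    rw [norm_pos_iff]
    intro h0
    have e1 : ⟪e₁, w⟫ = α := by simp [hw, inner_add_right, inner_smul_right, h₁, h₁₂]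
    have e2 : ⟪e₂, w⟫ = β := by simp [hw, inner_add_right, inner_smul_right, h₂, h₂₁]
    rw [h0, inner_zero_right] at e1 e2
    rcases hαβ with h | h
    · exact h e1.symm
    · exact h e2.symm
  have hopen : IsOpen {x : V | |⟪w, x⟫ - κ| < δ * ‖w‖ / 2} :=
    isOpen_lt (by fun_prop) continuous_const
  obtain ⟨j, hj⟩ := exists_subset_nhds_of_isCompact (V := Q) (directed_of_isDirected_le
    fun i j hij => hanti hij) (fun j => (hQ j).isCompact)
    (U := {x : V | |⟪w, x⟫ - κ| < δ * ‖w‖ / 2}) (fun x hx => hopen.mem_nhds (by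
      rw [mem_ofPred_eq, hκ x hx, sub_self, abs_zero]
      positivity))
  refine ⟨Q j, hQ0 ▸ hanti (Nat.zero_le j), hQ j, α, β, hαβ, fun x hx y hy => ?_⟩
  have hj' : ∀ x ∈ Q j, |⟪w, x⟫ - κ| < δ * ‖w‖ / 2 := fun x hx => hj hx
  have a1 : ⟪w, x⟫ - κ < δ * ‖w‖ / 2 := (abs_lt.1 (hj' x hx)).2
  have a2 : -(δ * ‖w‖ / 2) < ⟪w, y⟫ - κ := (abs_lt.1 (hj' y hy)).1
  rw [← hw, inner_sub_right]
  linarith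

/-- A needle: a body that is arbitrarily narrow in all directions of a subspace of given
dimension. -/
theorem IsNeedleCandidate.exists_needle {U C K : Set V} {p c : ℝ} (hK : IsNeedleCandidate U C p c K)
    (k : ℕ) (hk : k + 1 ≤ Module.finrank ℝ V) {δ : ℝ} (hδ : 0 < δ) :
    ∃ Q ⊆ K, IsNeedleCandidate U C p c Q ∧ ∃ S : Submodule ℝ V, Module.finrank ℝ S = k ∧
      ∀ x ∈ Q, ∀ y ∈ Q, ∀ w ∈ S, ⟪w, x - y⟫ ≤ δ * ‖w‖ := by
  induction k generalizing δ with
  | zero =>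
    refine ⟨K, subset_rfl, hK, ⊥, by simp, fun x _ y _ w hw => ?_⟩
    rw [Submodule.mem_bot] at hw
    simp [hw]
  | succ k ih =>
    obtain ⟨Q, hQK, hQ, S, hS, hnar⟩ := ih (by omega) (half_pos hδ)
    have hSo : Module.finrank ℝ Sᗮ = Module.finrank ℝ V - k := by
      have := S.finrank_add_finrank_orthogonal
      omega
    set b := stdOrthonormalBasis ℝ Sᗮ with hb
    let i₁ : Fin (Module.finrank ℝ Sᗮ) := ⟨0, by omega⟩
    let i₂ : Fin (Module.finrank ℝ Sᗮ) := ⟨1, by omega⟩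
    have hi : i₁ ≠ i₂ := by simp [i₁, i₂]
    have h₁ : ‖(b i₁ : V)‖ = 1 := b.orthonormal.1 i₁
    have h₂ : ‖(b i₂ : V)‖ = 1 := b.orthonormal.1 i₂
    have h₁₂ : ⟪(b i₁ : V), (b i₂ : V)⟫ = 0 := b.orthonormal.2 hi
    obtain ⟨Q', hQ'Q, hQ', α, β, hαβ, hnar'⟩ := hQ.exists_narrow h₁ h₂ h₁₂ (half_pos hδ)
    set w₀ : V := α • (b i₁ : V) + β • (b i₂ : V) with hw₀
    have hw₀S : w₀ ∈ Sᗮ := Sᗮ.add_mem (Sᗮ.smul_mem _ (b i₁).2) (Sᗮ.smul_mem _ (b i₂).2)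
    have hw₀0 : w₀ ≠ 0 := by
      intro h0
      have e1 : ⟪(b i₁ : V), w₀⟫ = α := by simp [hw₀, inner_add_right, inner_smul_right, h₁, h₁₂]
      have e2 : ⟪(b i₂ : V), w₀⟫ = β := by
        simp [hw₀, inner_add_right, inner_smul_right, h₂, real_inner_comm (b i₁ : V) (b i₂ : V),
          h₁₂]
      rw [h0, inner_zero_right] at e1 e2
      rcases hαβ with h | h
      · exact h e1.symm
      · exact h e2.symm
    have hdisj : S ⊓ ℝ ∙ w₀ = ⊥ := by
      rw [eq_bot_iff]
      have : ℝ ∙ w₀ ≤ Sᗮ := (Submodule.span_singleton_le_iff_mem _ _).2 hw₀S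
      exact (inf_le_inf_left _ this).trans S.inf_orthogonal_eq_bot.le
    refine ⟨Q', hQ'Q.trans hQK, hQ', S ⊔ ℝ ∙ w₀, ?_, ?_⟩
    · have := Submodule.finrank_sup_add_finrank_inf_eq S (ℝ ∙ w₀)
      rw [hdisj, finrank_bot, finrank_span_singleton hw₀0, hS] at this
      simpa using this
    · intro x hx y hy w hw
      obtain ⟨s, hs, t, ht, rfl⟩ := Submodule.mem_sup.1 hw
      obtain ⟨a, rfl⟩ := Submodule.mem_span_singleton.1 ht
      have horth : ⟪s, a • w₀⟫ = 0 := by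
        rw [inner_smul_right, Submodule.inner_right_of_mem_orthogonal hs hw₀S, mul_zero]
      have hn := norm_add_sq_eq_norm_sq_add_norm_sq_of_inner_eq_zero s (a • w₀) horth
      have hn1 : ‖s‖ ≤ ‖s + a • w₀‖ := by
        refine le_of_sq_le_sq ?_ (norm_nonneg _)
        nlinarith [norm_nonneg (a • w₀)]
      have hn2 : ‖a • w₀‖ ≤ ‖s + a • w₀‖ := by
        refine le_of_sq_le_sq ?_ (norm_nonneg _)
        nlinarith [norm_nonneg s]
      have b1 := hnar x (hQ'Q hx) y (hQ'Q hy) s hs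
      have b2 : ⟪a • w₀, x - y⟫ ≤ δ / 2 * ‖a • w₀‖ := by
        rw [real_inner_smul_left, norm_smul, Real.norm_eq_abs]
        rcases le_total 0 a with ha | ha
        · rw [abs_of_nonneg ha]
          nlinarith [mul_le_mul_of_nonneg_left (hnar' x hx y hy) ha]
        · rw [abs_of_nonpos ha]
          have := mul_le_mul_of_nonneg_left (hnar' y hy x hx) (neg_nonneg.2 ha)
          rw [← neg_sub x y, inner_neg_right] at this
          nlinarith
      rw [inner_add_left]
      nlinarith

end Bisection

/-! ### Marginals of convex bodies -/

section Marginal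

variable {V : Type*} [NormedAddCommGroup V] [InnerProductSpace ℝ V] [FiniteDimensional ℝ V]
  [MeasurableSpace V] [BorelSpace V]

/-- Volume-preserving linear coordinates whose first coordinate is the inner product with a given
unit vector. -/
theorem exists_measurePreserving_linearMap {k : ℕ} (hk : Module.finrank ℝ V = k + 1) {e : V}
    (he : ‖e‖ = 1) :
    ∃ T : ℝ × (Fin k → ℝ) →ₗ[ℝ] V, MeasurePreserving T ∧ Function.Injective T ∧
      ∀ q, ⟪e, T q⟫ = q.1 := by
  have hone : Orthonormal ℝ (({0} : Set (Fin (k + 1))).domRestrict fun _ => e) :=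
    ⟨fun _ => he, fun i j hij => absurd (Subsingleton.elim i j) hij⟩
  obtain ⟨b, hb⟩ := hone.exists_orthonormalBasis_extension_of_card_eq (by simp [hk])
  have hb0 : b 0 = e := hb 0 rfl
  let c : ℝ × (Fin k → ℝ) →ₗ[ℝ] (Fin (k + 1) → ℝ) :=
    { toFun := fun q => Fin.cons q.1 q.2
      map_add' := by
        intro p q
        funext i
        refine Fin.cases ?_ (fun j => ?_) i <;> simp
      map_smul' := by
        intro c q
        funext i
        refine Fin.cases ?_ (fun j => ?_) i <;> simp }
  have hc : MeasurePreserving c := by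
    have h := (volume_preserving_piFinSuccAbove (fun _ : Fin (k + 1) => ℝ) 0).symm
    convert! h using 1
    funext q
    simp only [c, LinearMap.coe_mk, AddHom.coe_mk, MeasurableEquiv.piFinSuccAbove_symm_apply,
      Fin.insertNthEquiv_zero]
    rfl
  refine ⟨b.repr.symm.toLinearEquiv.toLinearMap ∘ₗ
    (WithLp.linearEquiv 2 ℝ (Fin (k + 1) → ℝ)).symm.toLinearMap ∘ₗ c, ?_, ?_, ?_⟩
  · exact b.measurePreserving_repr_symm.comp ((PiLp.volume_preserving_toLp (Fin (k + 1))).comp hc)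
  · refine b.repr.symm.injective.comp ((WithLp.linearEquiv 2 ℝ _).symm.injective.comp ?_)
    intro p q hpq
    have hpq' : (Fin.cons p.1 p.2 : Fin (k + 1) → ℝ) = Fin.cons q.1 q.2 := hpq
    exact Prod.ext (by simpa using congrFun hpq' 0)
      (funext fun i => by simpa using congrFun hpq' i.succ)
  · intro q
    rw [← hb0, ← b.repr_apply_apply]
    simp [c]

theorem IsLogConcave.const_mul {E : Type*} [AddCommGroup E] [Module ℝ E] {f : E → ℝ≥0∞}
    (hf : IsLogConcave f) {c : ℝ≥0∞} (hc0 : c ≠ 0) (hc : c ≠ ∞) :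
    IsLogConcave fun x => c * f x := by
  refine IsLogConcave.mul (f := fun _ => c) (fun x y a b ha hb hab => ?_) hf
  rw [← ENNReal.rpow_add _ _ hc0 hc, hab, ENNReal.rpow_one]

theorem IsLogConcave.min_le {f : ℝ → ℝ≥0∞} (hf : IsLogConcave f) {x y z : ℝ} (hxy : x ≤ y)
    (hyz : y ≤ z) : min (f x) (f z) ≤ f y := by
  rcases hxy.eq_or_lt with rfl | hxy
  · exact min_le_left _ _
  rcases hyz.eq_or_lt with rfl | hyz
  · exact min_le_right _ _
  have hxz : 0 < z - x := by linarith
  have key := hf x z ((z - y) / (z - x)) ((y - x) / (z - x)) (div_pos (by linarith) hxz)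
    (div_pos (by linarith) hxz) (by field_simp; ring)
  have hy : ((z - y) / (z - x)) • x + ((y - x) / (z - x)) • z = y := by
    simp only [smul_eq_mul]
    field_simp
    ring
  rw [hy] at key
  refine le_trans ?_ key
  have h1 : 0 ≤ (z - y) / (z - x) := div_nonneg (by linarith) hxz.le
  have h2 : 0 ≤ (y - x) / (z - x) := div_nonneg (by linarith) hxz.le
  calc min (f x) (f z)
      = min (f x) (f z) ^ ((z - y) / (z - x)) * min (f x) (f z) ^ ((y - x) / (z - x)) := by
        rw [← ENNReal.rpow_add_of_nonneg _ _ h1 h2, ← add_div,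
          show z - y + (y - x) = z - x by ring, div_self hxz.ne', ENNReal.rpow_one]
    _ ≤ _ := by
        gcongr
        · exact min_le_left _ _
        · exact min_le_right _ _

/-- The integrals of a log-concave function over the sections of a convex planar set are log-concave;
with half-planes `D` these are the tails of a log-concave density. -/
theorem IsLogConcave.setLIntegral {g : ℝ → ℝ≥0∞} (hg : IsLogConcave g) (hgm : Measurable g)
    {D : Set (ℝ × ℝ)} (hD : Convex ℝ D) (hDm : MeasurableSet D) :
    IsLogConcave fun t => ∫⁻ x in {x | (t, x) ∈ D}, g x := by
  have hm : ∀ t, MeasurableSet {x | (t, x) ∈ D} := fun t => hDm.preimage measurable_prodMk_left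
  have h1 := (hD.isLogConcave_indicator.mul
    (hg.comp_linearMap (LinearMap.snd ℝ ℝ ℝ))).lintegral_prod_real (fun t =>
      ((measurable_const.indicator hDm).comp measurable_prodMk_left).mul hgm)
  convert h1 using 2 with t
  rw [← lintegral_indicator (hm t)]
  refine lintegral_congr fun x => ?_
  by_cases hx : (t, x) ∈ D
  · rw [indicator_of_mem (by exact hx), indicator_of_mem hx, one_mul]
    rfl
  · rw [indicator_of_notMem (by exact hx), indicator_of_notMem hx, zero_mul]

/-- The normalized one-dimensional marginal of a convex body has a quasiconcave density and
log-concave tails. -/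
theorem exists_marginal_density {k : ℕ} (hk : Module.finrank ℝ V = k + 1) {e : V}
    (he : ‖e‖ = 1) {Q : Set V} (hQ : IsCompact Q) (hQc : Convex ℝ Q) (hQ0 : volume Q ≠ 0) :
    ∃ φ : ℝ → ℝ, Measurable φ ∧ (∀ x, 0 ≤ φ x) ∧ (∀ x, x ∉ (fun v => ⟪e, v⟫) '' Q → φ x = 0) ∧
      (∀ x y z, x ≤ y → y ≤ z → min (φ x) (φ z) ≤ φ y) ∧
      (IsLogConcave fun t => volume.withDensity (fun x => ENNReal.ofReal (φ x)) (Iic t)) ∧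
      (IsLogConcave fun t => volume.withDensity (fun x => ENNReal.ofReal (φ x)) (Ici t)) ∧
      ∀ s, MeasurableSet s → volume.withDensity (fun x => ENNReal.ofReal (φ x)) s =
        (volume Q)⁻¹ * volume (Q ∩ (fun v => ⟪e, v⟫) ⁻¹' s) := by
  obtain ⟨T, hT, hTi, hTe⟩ := exists_measurePreserving_linearMap hk he
  have hQfin : volume Q ≠ ∞ := hQ.measure_lt_top.ne
  set K := T ⁻¹' Q with hK
  have hKc : IsCompact K := (T.isClosedEmbedding_of_injective
    (LinearMap.ker_eq_bot.2 hTi)).isCompact_preimage hQ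
  have hKconv : Convex ℝ K := hQc.linear_preimage T
  have hKm : MeasurableSet K := hKc.measurableSet
  have hemb : MeasurableEmbedding T := (T.isClosedEmbedding_of_injective
    (LinearMap.ker_eq_bot.2 hTi)).measurableEmbedding
  set f : ℝ × (Fin k → ℝ) → ℝ≥0∞ := K.indicator fun _ => 1 with hf
  have hfm : Measurable f := measurable_const.indicator hKm
  set Φ : ℝ → ℝ≥0∞ := fun s => (volume Q)⁻¹ * ∫⁻ y, f (s, y) with hΦ
  have hinner : ∀ s, ∫⁻ y, f (s, y) = volume (Prod.mk s ⁻¹' K) := by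
    intro s
    rw [← lintegral_indicator_one (hKm.preimage measurable_prodMk_left)]
    rfl
  have hΦm : Measurable Φ := (hfm.lintegral_prod_right').const_mul _
  have hΦlc : IsLogConcave Φ := (hKconv.isLogConcave_indicator.lintegral_prod_pi fun s =>
    hfm.comp measurable_prodMk_left).const_mul (ENNReal.inv_ne_zero.2 hQfin)
    (ENNReal.inv_ne_top.2 hQ0)
  have hΦfin : ∀ s, Φ s ≠ ∞ := by
    intro s
    refine ENNReal.mul_ne_top (ENNReal.inv_ne_top.2 hQ0) ?_
    rw [hinner]
    refine ne_top_of_le_ne_top (hKc.image continuous_snd).measure_lt_top.ne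
      (measure_mono (t := Prod.snd '' K) fun y hy => ⟨(s, y), hy, rfl⟩)
  have hofReal : (fun x => ENNReal.ofReal (Φ x).toReal) = Φ :=
    funext fun x => ENNReal.ofReal_toReal (hΦfin x)
  refine ⟨fun x => (Φ x).toReal, hΦm.ennreal_toReal, fun x => ENNReal.toReal_nonneg, ?_, ?_, ?_⟩
  · intro x hx
    have : Prod.mk x ⁻¹' K = ∅ := by
      rw [eq_empty_iff_forall_notMem]
      intro y hy
      exact hx ⟨T (x, y), hy, hTe (x, y)⟩
    simp [hΦ, hinner, this]
  · intro x y z hxy hyz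
    simp only
    rw [← ENNReal.toReal_min (hΦfin _) (hΦfin _)]
    exact ENNReal.toReal_mono (hΦfin y) (hΦlc.min_le hxy hyz)
  simp only [hofReal]
  refine ⟨?_, ?_, fun s hs => ?_⟩
  · simp only [withDensity_apply _ measurableSet_Iic]
    refine hΦlc.setLIntegral hΦm (D := {q | q.2 ≤ q.1}) ?_
      (measurableSet_le measurable_snd measurable_fst)
    intro p hp q hq a b ha hb hab
    simp only [mem_ofPred_eq, Prod.snd_add, Prod.fst_add, Prod.smul_fst, Prod.smul_snd,
      smul_eq_mul] at *
    gcongr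
  · simp only [withDensity_apply _ measurableSet_Ici]
    refine hΦlc.setLIntegral hΦm (D := {q | q.1 ≤ q.2}) ?_
      (measurableSet_le measurable_fst measurable_snd)
    intro p hp q hq a b ha hb hab
    simp only [mem_ofPred_eq, Prod.snd_add, Prod.fst_add, Prod.smul_fst, Prod.smul_snd,
      smul_eq_mul] at *
    gcongr
  · rw [withDensity_apply _ hs, hΦ, lintegral_const_mul _ (hfm.lintegral_prod_right'),
      ← hT.measure_preimage_emb hemb (Q ∩ _), Measure.volume_eq_prod,
      Measure.prod_apply ((hT.measurable (hQ.measurableSet.inter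
        (hs.preimage (by fun_prop : Measurable fun v : V => ⟪e, v⟫)))))]
    congr 1
    rw [← lintegral_indicator hs]
    refine lintegral_congr fun x => ?_
    by_cases hx : x ∈ s
    · rw [indicator_of_mem hx, hinner]
      congr 1
      ext y
      simp [hK, hTe, hx]
    · rw [indicator_of_notMem hx]
      symm
      convert! measure_empty (μ := volume)
      rw [eq_empty_iff_forall_notMem]
      intro y hy
      exact hx (by simpa [hTe] using hy.2)

end Marginal

/-! ### The inequality on a needle -/

theorem lineMap_image_subset_uIcc {x w : ℝ} {T : Set ℝ} (hT : T ⊆ Icc 0 1) :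
    AffineMap.lineMap x w '' T ⊆ uIcc x w := by
  rw [← segment_eq_uIcc, segment_eq_image_lineMap]
  exact image_mono hT

theorem volume_real_uIcc (a b : ℝ) : volume.real (uIcc a b) = |b - a| := by
  rw [Measure.real, Real.volume_interval, ENNReal.toReal_ofReal (abs_nonneg _)]

theorem volume_real_lineMap_image (x w : ℝ) (T : Set ℝ) :
    volume.real (AffineMap.lineMap x w '' T) = |w - x| * volume.real T := by
  have h : (AffineMap.lineMap x w '' T : Set ℝ) = (fun a => x + a) '' ((w - x) • T) := by
    ext a
    simp only [mem_image, mem_smul_set, AffineMap.lineMap_apply, vsub_eq_sub, vadd_eq_add,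
      smul_eq_mul, exists_exists_and_eq_and]
    constructor <;> rintro ⟨t, ht, rfl⟩ <;> exact ⟨t, ht, by ring⟩
  rw [h, Measure.real, image_add_left, measure_preimage_add, addHaar_smul]
  simp [Measure.real, ENNReal.toReal_mul]

section Needle

variable {V : Type*} [NormedAddCommGroup V] [InnerProductSpace ℝ V]

/-- The core condition passes to the image under a linear functional, and to limits. -/
theorem mul_volume_real_inter_uIcc_le {E Q C : Set V} {e : V} {lam Lo R : ℝ} (hlam : 1 < lam)
    (hQc : Convex ℝ Q) (hEQ : IsCompact (E ∩ Q))
    (hI : (fun v => ⟪e, v⟫) '' Q = Icc Lo R)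
    (hcore : ∀ x ∈ C, ∀ a ∈ Q,
      (lam - 1) / lam ≤ volume.real {t ∈ Icc (0 : ℝ) 1 | AffineMap.lineMap x a t ∈ E}) :
    ∀ x ∈ closure ((fun v => ⟪e, v⟫) '' (C ∩ Q)), ∀ w,
      lam * volume.real ((Icc Lo R \ (fun v => ⟪e, v⟫) '' (E ∩ Q)) ∩ uIcc x w) ≤ |w - x| := by
  have hlam0 : 0 < lam := by linarith
  set E₁ := (fun v => ⟪e, v⟫) '' (E ∩ Q) with hE₁
  set A := Icc Lo R \ E₁ with hA
  have hE₁m : MeasurableSet E₁ := (hEQ.image (by fun_prop)).measurableSet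
  have hfin : ∀ (s : Set ℝ) a b, volume (s ∩ uIcc a b) ≠ ∞ := fun s a b =>
    ne_top_of_le_ne_top (by simp [uIcc]) (measure_mono inter_subset_right : _ ≤ volume (uIcc a b))
  -- segments inside `[Lo, R]` are images of segments in `Q`
  have step1 : ∀ x ∈ C ∩ Q, ∀ w ∈ Icc Lo R,
      lam * volume.real (A ∩ uIcc ⟪e, x⟫ w) ≤ |w - ⟪e, x⟫| := by
    intro x hx w hw
    rw [← hI] at hw
    obtain ⟨a, ha, rfl⟩ := hw
    simp only
    set T := {t ∈ Icc (0 : ℝ) 1 | AffineMap.lineMap x a t ∈ E}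
    have hTE : AffineMap.lineMap ⟪e, x⟫ ⟪e, a⟫ '' T ⊆ E₁ ∩ uIcc ⟪e, x⟫ ⟪e, a⟫ := by
      refine subset_inter ?_ (lineMap_image_subset_uIcc fun t ht => ht.1)
      rintro _ ⟨t, ht, rfl⟩
      refine ⟨AffineMap.lineMap x a t, ⟨ht.2, hQc.lineMap_mem hx.2 ha ht.1⟩, ?_⟩
      simp [AffineMap.lineMap_apply, inner_add_right, inner_smul_right, inner_sub_right]
    have h1 := measureReal_mono hTE (hfin _ _ _)
    rw [volume_real_lineMap_image] at h1
    have h2 : volume.real (A ∩ uIcc ⟪e, x⟫ ⟪e, a⟫) + volume.real (E₁ ∩ uIcc ⟪e, x⟫ ⟪e, a⟫) ≤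
        |⟪e, a⟫ - ⟪e, x⟫| := by
      rw [← measureReal_union ?_ (hE₁m.inter measurableSet_uIcc) (hfin _ _ _) (hfin _ _ _),
        ← volume_real_uIcc]
      · exact measureReal_mono (union_subset inter_subset_right inter_subset_right)
          (by simp [uIcc])
      · rw [disjoint_left]
        exact fun y hy hy' => hy.1.2 hy'.1
    have h3 := mul_le_mul_of_nonneg_left (hcore x hx.1 a ha) (abs_nonneg (⟪e, a⟫ - ⟪e, x⟫))
    have h4 : lam * (|⟪e, a⟫ - ⟪e, x⟫| * ((lam - 1) / lam)) = |⟪e, a⟫ - ⟪e, x⟫| * (lam - 1) := by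
      field_simp
    have h5 : volume.real (A ∩ uIcc ⟪e, x⟫ ⟪e, a⟫) ≤
        |⟪e, a⟫ - ⟪e, x⟫| - |⟪e, a⟫ - ⟪e, x⟫| * ((lam - 1) / lam) := by linarith
    have h6 := mul_le_mul_of_nonneg_left h5 hlam0.le
    linarith
  -- endpoints outside `[Lo, R]` are moved to the boundary
  have step2 : ∀ x ∈ C ∩ Q, ∀ w, lam * volume.real (A ∩ uIcc ⟪e, x⟫ w) ≤ |w - ⟪e, x⟫| := by
    intro x hx w
    have hxI : ⟪e, x⟫ ∈ Icc Lo R := hI ▸ mem_image_of_mem _ hx.2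
    set w' := max Lo (min R w) with hw'
    have hw'I : w' ∈ Icc Lo R :=
      ⟨le_max_left _ _, max_le (hxI.1.trans hxI.2) (min_le_left _ _)⟩
    have hsub : A ∩ uIcc ⟪e, x⟫ w ⊆ A ∩ uIcc ⟪e, x⟫ w' := by
      rintro y ⟨hyA, hy⟩
      refine ⟨hyA, ?_⟩
      have hyI := hyA.1
      rw [mem_uIcc] at hy ⊢
      rcases hy with hy | hy
      · exact Or.inl ⟨hy.1, le_max_of_le_right (le_min hyI.2 hy.2)⟩
      · exact Or.inr ⟨max_le hyI.1 ((min_le_right _ _).trans hy.1), hy.2⟩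
    have habs : |w' - ⟪e, x⟫| ≤ |w - ⟪e, x⟫| := by
      rcases le_total w ⟪e, x⟫ with h | h
      · have h1 : w ≤ w' := le_max_of_le_right (le_min (h.trans hxI.2) le_rfl)
        have h2 : w' ≤ ⟪e, x⟫ := max_le hxI.1 ((min_le_right _ _).trans h)
        rw [abs_of_nonpos (by linarith), abs_of_nonpos (by linarith)]
        linarith
      · have h1 : w' ≤ w := max_le (hxI.1.trans h) (min_le_right _ _)
        have h2 : ⟪e, x⟫ ≤ w' := le_max_of_le_right (le_min hxI.2 h)
        rw [abs_of_nonneg (by linarith), abs_of_nonneg (by linarith)]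
        linarith
    refine le_trans ?_ ((step1 x hx w' hw'I).trans habs)
    exact mul_le_mul_of_nonneg_left (measureReal_mono hsub (hfin _ _ _)) hlam0.le
  -- points of the closure are approximated by images of points of `C`
  intro x hx w
  refine le_of_forall_pos_le_add fun ε hε => ?_
  obtain ⟨_, ⟨x', hx', rfl⟩, hdist⟩ := Metric.mem_closure_iff.1 hx (ε / (1 + lam)) (by positivity)
  rw [Real.dist_eq] at hdist
  simp only at hdist
  have h1 : volume.real (A ∩ uIcc x w) ≤
      volume.real (A ∩ uIcc ⟪e, x'⟫ w) + |x - ⟪e, x'⟫| := by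
    rw [← volume_real_uIcc]
    have hfin' : volume (A ∩ uIcc ⟪e, x'⟫ w ∪ uIcc ⟪e, x'⟫ x) ≠ ∞ :=
      (measure_union_lt_top (hfin _ _ _).lt_top (by simp [uIcc])).ne
    refine (measureReal_mono (fun y hy => ?_) hfin').trans (measureReal_union_le _ _)
    rcases uIcc_subset_uIcc_union_uIcc (b := ⟪e, x'⟫) hy.2 with h | h
    · exact Or.inr (uIcc_comm x _ ▸ h)
    · exact Or.inl ⟨hy.1, h⟩
  have h2 := step2 x' hx' w
  have h3 : |w - ⟪e, x'⟫| ≤ |w - x| + |x - ⟪e, x'⟫| := abs_sub_le _ _ _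
  have h4 : (1 + lam) * |x - ⟪e, x'⟫| ≤ ε := by
    rw [lt_div_iff₀ (by linarith)] at hdist
    linarith
  have h5 := mul_le_mul_of_nonneg_left h1 hlam0.le
  linarith

variable [FiniteDimensional ℝ V] [MeasurableSpace V] [BorelSpace V]

/-- On a needle whose fibres have diameter at most `δ`, the neighbourhood `U` of `E` contains all
fibres that meet `E`, so the one-dimensional inequality for the marginal applies. -/
theorem IsNeedleCandidate.le_rpow_of_narrow {U C E Q : Set V} {p c lam δ : ℝ} {k : ℕ}
    (hQ : IsNeedleCandidate U C p c Q) (hk : Module.finrank ℝ V = k + 1) (hlam : 1 < lam)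
    (hδ : 0 ≤ δ) {S : Submodule ℝ V} (hS : Module.finrank ℝ S = k)
    (hnar : ∀ x ∈ Q, ∀ y ∈ Q, ∀ w ∈ S, ⟪w, x - y⟫ ≤ δ * ‖w‖)
    (hE : IsClosed E) (hEU : ∀ x ∈ E, ∀ y, dist y x ≤ δ → y ∈ U) (hCE : C ⊆ E)
    (hcore : ∀ x ∈ C, ∀ a ∈ Q,
      (lam - 1) / lam ≤ volume.real {t ∈ Icc (0 : ℝ) 1 | AffineMap.lineMap x a t ∈ E}) :
    c ≤ p ^ lam := by
  have hlam0 : 0 < lam := by linarith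
  have hQfin : volume Q ≠ ∞ := hQ.isCompact.measure_lt_top.ne
  have hQ0 : volume Q ≠ 0 := fun h => hQ.pos.ne' (by simp [Measure.real, h])
  have hQne : Q.Nonempty := nonempty_of_measure_ne_zero hQ0
  -- `e` is a unit normal of the hyperplane `S`
  have hSo : Module.finrank ℝ Sᗮ = 1 := by
    have := S.finrank_add_finrank_orthogonal
    omega
  set b := stdOrthonormalBasis ℝ Sᗮ with hb
  set e : V := (b ⟨0, by omega⟩).1 with he
  have he1 : ‖e‖ = 1 := b.orthonormal.1 _
  have heS : e ∈ Sᗮ := (b ⟨0, by omega⟩).2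
  have hspan : Sᗮ = ℝ ∙ e := by
    symm
    refine Submodule.eq_of_le_of_finrank_eq ((Submodule.span_singleton_le_iff_mem _ _).2 heS) ?_
    rw [hSo, finrank_span_singleton (by rw [← norm_ne_zero_iff, he1]; exact one_ne_zero)]
  -- fibres are short because a difference in a fibre is itself a direction of `S`
  have hfib : ∀ x ∈ Q, ∀ y ∈ Q, ⟪e, x⟫ = ⟪e, y⟫ → dist x y ≤ δ := by
    intro x hx y hy hxy
    have hmem : x - y ∈ S := by
      rw [← S.orthogonal_orthogonal, hspan, Submodule.mem_orthogonal_singleton_iff_inner_right,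
        inner_sub_right, hxy, sub_self]
    have h1 := hnar x hx y hy _ hmem
    rw [real_inner_self_eq_norm_sq, sq] at h1
    rw [dist_eq_norm]
    rcases (norm_nonneg (x - y)).eq_or_lt with h | h
    · rw [← h]
      exact hδ
    · exact le_of_mul_le_mul_right h1 h
  have hcontl : Continuous fun v : V => ⟪e, v⟫ := by fun_prop
  set Lo := sInf ((fun v => ⟪e, v⟫) '' Q) with hLo
  set R := sSup ((fun v => ⟪e, v⟫) '' Q) with hR
  have hI : (fun v => ⟪e, v⟫) '' Q = Icc Lo R := eq_Icc_of_connected_compact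
    ((hQ.convex.isConnected hQne).image _ hcontl.continuousOn)
    (hQ.isCompact.image hcontl)
  have hLR : Lo ≤ R := by
    rw [← nonempty_Icc, ← hI]
    exact hQne.image _
  obtain ⟨φ, hφm, hφ0, hsupp, hφ, hP, hG, hval⟩ :=
    exists_marginal_density hk he1 hQ.isCompact hQ.convex hQ0
  rw [hI] at hsupp
  set μ := volume.withDensity fun x => ENNReal.ofReal (φ x) with hμ
  have hprob : IsProbabilityMeasure μ := ⟨by
    rw [hval _ MeasurableSet.univ, preimage_univ, inter_univ, ENNReal.inv_mul_cancel hQ0 hQfin]⟩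
  have hvalr : ∀ s, MeasurableSet s →
      μ.real s * volume.real Q = volume.real (Q ∩ (fun v => ⟪e, v⟫) ⁻¹' s) := by
    intro s hs
    rw [Measure.real, hval s hs, ENNReal.toReal_mul, ENNReal.toReal_inv, mul_comm, ← mul_assoc]
    change volume.real Q * (volume.real Q)⁻¹ * _ = _
    rw [mul_inv_cancel₀ hQ.pos.ne', one_mul]
    rfl
  have hEQ : IsCompact (E ∩ Q) := hQ.isCompact.inter_left hE
  set E₁ := (fun v => ⟪e, v⟫) '' (E ∩ Q) with hE₁
  have hE₁c : IsCompact E₁ := hEQ.image hcontl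
  set C₁ := closure ((fun v => ⟪e, v⟫) '' (C ∩ Q)) with hC₁
  have hC₁E₁ : C₁ ⊆ E₁ :=
    closure_minimal (image_mono (inter_subset_inter_left _ hCE)) hE₁c.isClosed
  have main := measureReal_le_one_sub_rpow hφm hφ0 hφ hLR hsupp hμ hP hG (A := Icc Lo R \ E₁)
    (C := C₁) (measurableSet_Icc.diff hE₁c.measurableSet) sdiff_subset isClosed_closure
    (by
      rw [disjoint_left]
      exact fun x hx hx' => hx.2 (hC₁E₁ hx')) hlam
    (mul_volume_real_inter_uIcc_le hlam hQ.convex hEQ hI hcore)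
  have hone : μ.real (Icc Lo R) = 1 := by
    have h1 := hvalr (Icc Lo R) measurableSet_Icc
    have h2 : Q ∩ (fun v => ⟪e, v⟫) ⁻¹' Icc Lo R = Q :=
      inter_eq_left.2 fun x hx => hI ▸ mem_image_of_mem _ hx
    rw [h2] at h1
    exact mul_right_cancel₀ hQ.pos.ne' (h1.trans (one_mul _).symm)
  have hE₁I : E₁ ⊆ Icc Lo R := hI ▸ image_mono inter_subset_right
  rw [measureReal_sdiff hE₁I hE₁c.measurableSet, hone, sub_sub_cancel] at main
  -- `c ≤ μ C₁`
  have hc : c ≤ μ.real C₁ := by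
    refine le_of_mul_le_mul_right ?_ hQ.pos
    rw [hvalr _ isClosed_closure.measurableSet]
    refine hQ.le_prop.trans (measureReal_mono (fun x hx => ⟨hx.2, ?_⟩)
      (ne_top_of_le_ne_top hQfin (measure_mono inter_subset_left)))
    exact subset_closure (mem_image_of_mem _ hx)
  -- `μ E₁ ≤ p`
  have hp : μ.real E₁ ≤ p := by
    refine le_of_mul_le_mul_right ?_ hQ.pos
    rw [hvalr _ hE₁c.measurableSet, ← hQ.prop_eq]
    refine measureReal_mono (fun x hx => ⟨?_, hx.1⟩)
      (ne_top_of_le_ne_top hQfin (measure_mono inter_subset_right))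
    obtain ⟨hxQ, y, ⟨hyE, hyQ⟩, hy⟩ := hx
    exact hEU y hyE x (hfib x hxQ y hyQ hy.symm)
  exact hc.trans (main.trans (Real.rpow_le_rpow measureReal_nonneg hp hlam0.le))

end Needle

/-! ### The core -/

/-- A core point sees at least the proportion `(lam - 1) / lam` of `E` on every segment that starts
at it. -/
theorem le_volume_real_lineMap_of_mem_core {n : ℕ} {lam : ℝ} (hlam : 1 < lam)
    {F E : Set (EuclideanSpace ℝ (Fin n))} (hF : Convex ℝ F) (hEF : E ⊆ F)
    {x a : EuclideanSpace ℝ (Fin n)} (hx : x ∈ core lam F E) (ha : a ∈ F) :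
    (lam - 1) / lam ≤ volume.real {t ∈ Icc (0 : ℝ) 1 | AffineMap.lineMap x a t ∈ E} := by
  have hle1 : (lam - 1) / lam ≤ 1 := by
    rw [div_le_one (by linarith)]
    linarith
  by_cases hxa : x = a
  · subst hxa
    have : {t ∈ Icc (0 : ℝ) 1 | AffineMap.lineMap x x t ∈ E} = Icc 0 1 := by
      ext t
      simp [hx.1]
    rw [this]
    simpa [Measure.real] using hle1
  have h := hx.2 x a hxa (left_mem_segment ℝ x a) (hF.segment_subset (hEF hx.1) ha)
  have hlen : ∀ s : Set ℝ, segmentLength (AffineMap.lineMap x a '' s) =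
      dist x a * volume.real s := by
    intro s
    rw [segmentLength, Measure.real, hausdorffMeasure_lineMap_image, hausdorffMeasure_real]
    simp [Measure.real, ENNReal.smul_def, ENNReal.toReal_mul, edist_dist]
  have hE : E ∩ segment ℝ x a =
      AffineMap.lineMap x a '' {t ∈ Icc (0 : ℝ) 1 | AffineMap.lineMap x a t ∈ E} := by
    rw [segment_eq_image_lineMap]
    ext y
    constructor
    · rintro ⟨hy, t, ht, rfl⟩
      exact ⟨t, ⟨ht, hy⟩, rfl⟩
    · rintro ⟨t, ⟨ht, hy⟩, rfl⟩
      exact ⟨hy, t, ht, rfl⟩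
  rw [hE, segment_eq_image_lineMap, hlen, hlen,
    mul_div_mul_left _ _ (dist_pos.2 hxa).ne'] at h
  simpa [Measure.real] using h

theorem mainTheorem1 (n : ℕ) (F E : Set (EuclideanSpace ℝ (Fin n)))
    (hFcompact : IsCompact F) (hFconvex : Convex ℝ F) (hFint : (interior F).Nonempty)
    (hEF : E ⊆ F) (hE : IsClosed E) (lam : ℝ) (hlam : 1 < lam) :
    volume.real (core lam F E) / volume.real F ≤ (volume.real E / volume.real F) ^ lam := by
  have hlam0 : 0 < lam := by linarith
  have hFfin : volume F ≠ ∞ := hFcompact.measure_lt_top.ne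
  have hFpos : 0 < volume.real F := by
    refine ENNReal.toReal_pos (fun h => ?_) hFfin
    exact (isOpen_interior.measure_pos volume hFint).ne' (measure_mono_null interior_subset h)
  have hEfin : volume E ≠ ∞ := ne_top_of_le_ne_top hFfin (measure_mono hEF)
  have hcoreE : core lam F E ⊆ E := fun x hx => hx.1
  rcases n with _ | k
  · -- in dimension zero `E` is empty or the whole space
    rcases E.eq_empty_or_nonempty with rfl | hne
    · rw [subset_empty_iff.1 hcoreE]
      simp [hlam0.ne']
    · have hEF' : E = F := by
        obtain ⟨x, hx⟩ := hne
        exact hEF.antisymm fun y _ => Subsingleton.elim x y ▸ hx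
      have h1 : volume.real E / volume.real F = 1 := by rw [hEF', div_self hFpos.ne']
      rw [h1, Real.one_rpow, div_le_one hFpos]
      exact measureReal_mono (hcoreE.trans hEF) hFfin
  by_contra! hcon
  set c := volume.real (core lam F E) / volume.real F with hc
  -- an open neighbourhood `U` of `E` of slightly larger volume still violates the inequality
  obtain ⟨r, hr, hrc⟩ : ∃ r, volume.real E < r ∧ (r / volume.real F) ^ lam < c := by
    have hcont : Continuous fun r : ℝ => (r / volume.real F) ^ lam :=
      (Real.continuous_rpow_const hlam0.le).comp (continuous_id.div_const _)
    obtain ⟨r, h1, h2⟩ := (((hcont.tendsto _).mono_left nhdsWithin_le_nhds).eventually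
      (gt_mem_nhds hcon) |>.and (self_mem_nhdsWithin (s := Ioi (volume.real E)))).exists
    exact ⟨r, h2, h1⟩
  obtain ⟨U, hEU, hUo, hUr⟩ := E.exists_isOpen_lt_of_lt (ENNReal.ofReal r)
    ((ENNReal.lt_ofReal_iff_toReal_lt hEfin).2 hr)
  obtain ⟨δ, hδ, hδU⟩ := (hFcompact.of_isClosed_subset hE hEF).exists_cthickening_subset_open
    hUo hEU
  set p := volume.real (U ∩ F) / volume.real F with hp
  have hUF : volume.real (U ∩ F) ≤ r :=
    (ENNReal.toReal_mono (hUr.trans ENNReal.ofReal_lt_top).ne (measure_mono inter_subset_left)).trans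
      ((ENNReal.lt_ofReal_iff_toReal_lt (hUr.trans ENNReal.ofReal_lt_top).ne).1 hUr).le
  have hcand : IsNeedleCandidate U (core lam F E) p c F := by
    refine ⟨hFcompact, hFconvex, hFpos, ?_, ?_⟩
    · rw [hp, div_mul_cancel₀ _ hFpos.ne']
    · rw [hc, div_mul_cancel₀ _ hFpos.ne', inter_eq_left.2 (hcoreE.trans hEF)]
  have hfr : Module.finrank ℝ (EuclideanSpace ℝ (Fin (k + 1))) = k + 1 := by simp
  obtain ⟨Q, hQF, hQ, S, hS, hnar⟩ := hcand.exists_needle k hfr.ge hδ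
  have key := hQ.le_rpow_of_narrow hfr hlam hδ.le hS hnar hE
    (fun x hx y hy => hδU (Metric.mem_cthickening_of_dist_le y x δ E hx hy)) hcoreE
    (fun x hx a ha => le_volume_real_lineMap_of_mem_core hlam hFconvex hEF hx (hQF ha))
  have : p ^ lam ≤ (r / volume.real F) ^ lam :=
    Real.rpow_le_rpow (by positivity) (by rw [hp]; gcongr) hlam0.le
  linarith
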